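/- Let $X$ be a real Hilbert space and $U$ a separable real Hilbert space. Let $A$ be the generator of a strongly continuous semigroup $(e^{At})_{t\ge 0}$ on $X$ such that $e^{At}$ is a compact operator for every $t>0$. Let $g:X\to X$ be Lipschitz on bounded subsets of $X$ and let $h:U\to X$ be a bounded linear operator. Suppose that for some constants $\omega\in(0,\infty)$, $C\in\mathbb{R}$ and $\omega'\in(-\infty,\omega)$ $$\|e^{At}\|\le e^{-\omega t}\quad(t\ge 0)\qquad\text{and}\qquad \langle x,g(x)\rangle\le C+\omega'\|x\|^2\quad(x\in X).$$ Let $\mathcal{U}:=S^\infty([0,\infty),U)$ be the set of all $u\in L^\infty([0,\infty),U)$ for which there are step functions $u_n:[0,\infty)\to U$ with compact support such that $\|(u_n-u)|_{[0,R]}\|_{\infty}\to 0$ for every $R>0$. Here $f$ is a step function with compact support if there are finitely many points $0=t_0<t_1<\dots<t_m<\infty$ such that $f$ is constant on each $(t_{i-1},t_i)$ and zero on $(t_m,\infty)$. For $\tau\ge0$ let $T(\tau)u:=u(\cdot+\tau)$. A mild solution of $\dot x=Ax+g(x)+hu$, $x(s)=x_s$, on $[s,b)$, where $s<b\le\infty$,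 is a continuous function $x:[s,b)\to X$ with $$x(t)=e^{A(t-s)}x_s+\int_s^t e^{A(t-r)}g(x(r))\,dr+\int_s^t e^{A(t-r)}hu(r)\,dr\qquad(t\in[s,b));$$ it is maximal if it cannot be extended to a mild solution on a longer interval $[s,b')$ with $b'>b$. Then the following statements hold. 1. For every $s\ge0$, $x_s\in X$ and $u\in\mathcal{U}$ there is exactly one maximal mild solution of $\dot x=Ax+g(x)+hu$, $x(s)=x_s$, and it is global, that is, defined on $[s,\infty)$. Denote its value at time $t\ge s$ by $S_u(t,s,x_s)$. 2. $(S_u)_{u\in\mathcal{U}}$ is a semiprocess family with input space $\mathcal{U}$ and translation $T$: one has $T(\tau)\mathcal{U}\subset\mathcal{U}$ for all $\tau\ge0$, and for all $u\in\mathcal U$, $x\in X$, $\tau\ge0$ and $t\ge s\ge r\ge 0$ $$S_u(s,s,x)=x,\qquad S_u(t,s,S_u(s,r,x))=S_u(t,r,x),\qquad S_u(t+\tau,s+\tau,x)=S_{T(\tau)u}(t,s,x).$$ 3. The undisturbed semiprocess $S_{\{0\}}$ has a unique global attractor $\Theta$, that is, there is exactly one compact set $\Theta\subset X$ such that $\sup_{x\in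 B}\operatorname{dist}(S_0(t,0,x),\Theta)\to0$ as $t\to\infty$ for every bounded $B\subset X$, and $\Theta\subset S_0(t,0,\Theta)$ for every $t\ge0$. Here $\operatorname{dist}(y,\emptyset)=\infty$; in particular $\Theta\neq\emptyset$. 4. $(S_u)_{u\in\mathcal{U}}$ is input-to-state practically stable with respect to $\Theta$: with $\|x\|_\Theta:=\inf_{\theta\in\Theta}\|x-\theta\|$ there exist $\beta\in\mathcal{KL}$, $\gamma\in\mathcal{K}$ and $c\in[0,\infty)$ such that $$\|S_u(t,0,x_0)\|_\Theta\le\beta(\|x_0\|_\Theta,t)+\gamma(\|u\|_\infty)+c\qquad(t\ge0,\ x_0\in X,\ u\in\mathcal{U}).$$ Here $\mathcal{K}$ is the set of continuous strictly increasing $\gamma:[0,\infty)\to[0,\infty)$ with $\gamma(0)=0$, and $\mathcal{KL}$ is the set of continuous $\beta:[0,\infty)^2\to[0,\infty)$ such that $\beta(\cdot,t)\in\mathcal{K}$ for every $t\ge0$ and, for every $r>0$, $\beta(r,\cdot)$ is strictly decreasing with limit $0$ at infinity. -/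

import Mathlib

open Set Filter Topology MeasureTheory
open scoped NNReal ENNReal

namespace ISpSMild

/-! ### Comparison functions -/

/-- The class `𝒦`: continuous, strictly increasing, zero at zero. -/
structure IsClassK (γ : ℝ≥0 → ℝ≥0) : Prop where
  continuous : Continuous γ
  strictMono : StrictMono γ
  zero : γ 0 = 0

/-- The class `ℒ`: continuous, strictly decreasing, with limit zero at infinity. -/
structure IsClassL (γ : ℝ≥0 → ℝ≥0) : Prop where
  continuous : Continuous γ
  strictAnti : StrictAnti γ
  tendsto : Tendsto γ atTop (𝓝 0)

/-- The class `𝒦ℒ`. -/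
structure IsClassKL (β : ℝ≥0 → ℝ≥0 → ℝ≥0) : Prop where
  continuous : Continuous (fun p : ℝ≥0 × ℝ≥0 => β p.1 p.2)
  classK : ∀ t, IsClassK (fun s => β s t)
  classL : ∀ s, 0 < s → IsClassL (fun t => β s t)

/-! ### Input space -/

section Inputs

variable {U : Type*} [NormedAddCommGroup U]

/-- Lebesgue measure on the half line `[0, ∞)`. -/
noncomputable abbrev halfLine : Measure ℝ := volume.restrict (Ici (0 : ℝ))

variable (U) in
/-- `L^∞([0, ∞), U)`, as a space of classes modulo equality almost everywhere. -/
abbrev LInfty : Type _ := Lp U ∞ halfLine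

/-- Step functions with compact support on `[0, ∞)`: there are finitely many points
`0 = t 0 < t 1 < ⋯ < t m` such that `f` is constant on each `(t i, t (i + 1))` and vanishes on
`(t m, ∞)`. Values at negative arguments are irrelevant. -/
def IsCompactStep (f : ℝ → U) : Prop :=
  ∃ (m : ℕ) (t : ℕ → ℝ), t 0 = 0 ∧ (∀ i < m, t i < t (i + 1)) ∧
    (∀ i < m, ∃ c : U, ∀ r ∈ Ioo (t i) (t (i + 1)), f r = c) ∧
    ∀ r, t m < r → f r = 0

variable (U) in
/-- `S^∞([0, ∞), U)`: the elements of `L^∞([0, ∞), U)` that are limits in `L^∞_loc` of step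
functions with compact support. -/
def SInfty : Set (LInfty U) :=
  {u | ∃ f : ℕ → ℝ → U, (∀ n, IsCompactStep (f n)) ∧
    ∀ t₀ : ℝ, 0 < t₀ →
      Tendsto (fun n => eLpNorm (fun r => f n r - u r) ∞ (volume.restrict (Icc 0 t₀)))
        atTop (𝓝 0)}

theorem zero_mem_SInfty : (0 : LInfty U) ∈ SInfty U := by
  refine ⟨fun _ _ => 0, fun _ => ⟨0, fun _ => 0, rfl, by simp, by simp, by simp⟩, ?_⟩
  intro t₀ _
  have h : (fun r => (0 : U) - (0 : LInfty U) r) =ᵐ[volume.restrict (Icc 0 t₀)] 0 := by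
    have h0 : ((0 : LInfty U) : ℝ → U) =ᵐ[halfLine] 0 := Lp.coeFn_zero U ∞ halfLine
    have hle : volume.restrict (Icc 0 t₀) ≤ halfLine :=
      Measure.restrict_mono (fun x hx => hx.1) le_rfl
    filter_upwards [ae_mono hle h0] with r hr
    have hr' : (0 : LInfty U) r = 0 := hr
    show (0 : U) - (0 : LInfty U) r = 0
    rw [hr', sub_zero]
  have h2 : eLpNorm (fun r => (0 : U) - (0 : LInfty U) r) ∞ (volume.restrict (Icc 0 t₀)) = 0 := by
    rw [eLpNorm_congr_ae h, eLpNorm_zero]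
  change Tendsto (fun _ : ℕ => eLpNorm (fun r => (0 : U) - (0 : LInfty U) r) ∞
    (volume.restrict (Icc 0 t₀))) atTop (𝓝 0)
  rw [h2]
  exact tendsto_const_nhds

variable (U) in
/-- The zero input, as an element of `S^∞`. -/
noncomputable def zeroInput : SInfty U := ⟨0, zero_mem_SInfty⟩

theorem quasiMeasurePreserving_add (h : ℝ≥0) :
    Measure.QuasiMeasurePreserving (fun t : ℝ => t + h) halfLine halfLine := by
  refine ⟨measurable_add_const _, ?_⟩
  refine Measure.AbsolutelyContinuous.mk fun s hs h0 => ?_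
  rw [Measure.map_apply (measurable_add_const _) hs,
    Measure.restrict_apply (measurable_add_const _ hs)]
  rw [Measure.restrict_apply hs] at h0
  refine measure_mono_null (t := (fun t : ℝ => t + h) ⁻¹' (s ∩ Ici 0)) ?_ ?_
  · rintro t ⟨ht, ht0⟩
    exact ⟨ht, add_nonneg ht0 h.2⟩
  · rw [measure_preimage_add_right]
    exact h0

theorem memLp_translate (h : ℝ≥0) (u : LInfty U) :
    MemLp (fun t : ℝ => u (t + h)) ∞ halfLine := by
  have hq := quasiMeasurePreserving_add h
  refine memLp_top_of_bound ((Lp.aestronglyMeasurable u).comp_quasiMeasurePreserving hq) ‖u‖ ?_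
  refine hq.ae (p := fun t => ‖u t‖ ≤ ‖u‖) ?_
  have h1 := ae_le_eLpNormEssSup (f := u) (μ := halfLine)
  filter_upwards [h1] with t ht
  rw [Lp.norm_def, eLpNorm_exponent_top]
  have hfin : eLpNormEssSup u halfLine ≠ ∞ := by
    have := Lp.eLpNorm_ne_top u
    rwa [eLpNorm_exponent_top] at this
  have := ENNReal.toReal_mono hfin ht
  simpa using this

/-- Left translation `T(h) u = u(· + h)` on `L^∞([0, ∞), U)`. -/
noncomputable def translate (h : ℝ≥0) (u : LInfty U) : LInfty U :=
  (memLp_translate h u).toLp (fun t : ℝ => u (t + h))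

end Inputs

/-! ### Semiprocess families and attractors -/

/-- `(S v)_{v ∈ V}` is a semiprocess family on `X` with input space `V` and translation `T`.
The value `S v t s x` is only meaningful for `0 ≤ s ≤ t`. -/
structure IsSemiprocessFamily {X W : Type*} (V : Set W) (T : ℝ≥0 → W → W)
    (S : V → ℝ → ℝ → X → X) : Prop where
  invariant : ∀ h : ℝ≥0, MapsTo (T h) V V
  refl : ∀ (v : V) (s : ℝ) (x : X), 0 ≤ s → S v s s x = x
  trans : ∀ (v : V) (r s t : ℝ) (x : X), 0 ≤ r → r ≤ s → s ≤ t →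
    S v t s (S v s r x) = S v t r x
  translation : ∀ (v : V) (s t : ℝ) (h : ℝ≥0) (x : X), 0 ≤ s → s ≤ t →
    S v (t + h) (s + h) x = S ⟨T h v, invariant h v.2⟩ t s x

/-- The set-valued semiprocess `S_{V'}(t, s, M) = {S v t s x | v ∈ V', x ∈ M}` for a set `V'` of
inputs. -/
def setSemiprocess {X I : Type*} (S : I → ℝ → ℝ → X → X) (V' : Set I) (t s : ℝ) (M : Set X) :
    Set X :=
  {y | ∃ v ∈ V', ∃ x ∈ M, y = S v t s x}

/-- `Θ` is a global attractor of the set-valued semiprocess `S_{V'}`. Distances take values in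
`[0, ∞]`, the distance to the empty set being `∞`. -/
structure IsGlobalAttractor {X I : Type*} [NormedAddCommGroup X] (S : I → ℝ → ℝ → X → X)
    (V' : Set I) (Θ : Set X) : Prop where
  isCompact : IsCompact Θ
  attractive : ∀ B : Set X, Bornology.IsBounded B →
    Tendsto (fun t : ℝ => ⨆ y ∈ setSemiprocess S V' t 0 B, Metric.infEDist y Θ) atTop (𝓝 0)
  negInvariant : ∀ t : ℝ, 0 ≤ t → Θ ⊆ setSemiprocess S V' t 0 Θ

/-- Input-to-state practical stability with respect to a (nonempty) set `Θ`, for a family of maps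
indexed by a set of inputs in a normed space. -/
def IsISpS {X W : Type*} [NormedAddCommGroup X] [NormedAddCommGroup W] {V : Set W}
    (S : V → ℝ → ℝ → X → X) (Θ : Set X) : Prop :=
  ∃ (β : ℝ≥0 → ℝ≥0 → ℝ≥0) (γ : ℝ≥0 → ℝ≥0) (c : ℝ≥0), IsClassKL β ∧ IsClassK γ ∧
    ∀ (x₀ : X) (u : V) (t : ℝ≥0),
      Metric.infNndist (S u t 0 x₀) Θ ≤ β (Metric.infNndist x₀ Θ) t + γ ‖(u : W)‖₊ + c

/-! ### Semigroups and mild solutions -/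

section Semigroups

variable {X : Type*} [NormedAddCommGroup X] [NormedSpace ℝ X]

/-- Strongly continuous semigroup of bounded linear operators `(T t)_{t ≥ 0}`.
Values of `T` at negative arguments are irrelevant. -/
structure IsC0Semigroup (T : ℝ → X →L[ℝ] X) : Prop where
  zero : T 0 = ContinuousLinearMap.id ℝ X
  add : ∀ s t : ℝ, 0 ≤ s → 0 ≤ t → T (s + t) = (T s).comp (T t)
  continuousOn : ∀ x : X, ContinuousOn (fun t => T t x) (Ici 0)

/-- The unbounded operator `A` generates the strongly continuous semigroup `T`: `x ∈ D(A)` and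
`A x = y` iff `(T t x - x) / t → y` as `t ↓ 0`. -/
structure Generates (A : X →ₗ.[ℝ] X) (T : ℝ → X →L[ℝ] X) : Prop where
  isC0Semigroup : IsC0Semigroup T
  mem_graph_iff : ∀ x y : X, (x, y) ∈ A.graph ↔
    Tendsto (fun t : ℝ => t⁻¹ • (T t x - x)) (𝓝[>] 0) (𝓝 y)

/-- The semigroup `T` is (immediately) compact. -/
def IsCompactSemigroup (T : ℝ → X →L[ℝ] X) : Prop :=
  ∀ t : ℝ, 0 < t → IsCompactOperator (T t)

variable {U : Type*} [NormedAddCommGroup U] [NormedSpace ℝ U]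

/-- The time interval `[s, τ)` with `τ ≤ ∞`. -/
def timeInterval (s : ℝ) (τ : EReal) : Set ℝ := {t | s ≤ t ∧ (t : EReal) < τ}

/-- `x` is a mild solution on `[s, τ)` of `x' = A x + g(x) + h v`, `x(s) = xs`, where `A` generates
the semigroup `T`. -/
structure IsMildSolution (T : ℝ → X →L[ℝ] X) (g : X → X) (h : U →L[ℝ] X) (v : ℝ → U)
    (s : ℝ) (xs : X) (τ : EReal) (x : ℝ → X) : Prop where
  lt : (s : EReal) < τ
  continuousOn : ContinuousOn x (timeInterval s τ)
  eq : ∀ t ∈ timeInterval s τ,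
    x t = T (t - s) xs + (∫ r in s..t, T (t - r) (g (x r))) + ∫ r in s..t, T (t - r) (h (v r))

/-- `x` is a maximal mild solution, with interval of existence `[s, τ)`: it is a mild solution
there and cannot be extended to a mild solution on a longer interval. -/
structure IsMaximalMildSolution (T : ℝ → X →L[ℝ] X) (g : X → X) (h : U →L[ℝ] X) (v : ℝ → U)
    (s : ℝ) (xs : X) (τ : EReal) (x : ℝ → X) : Prop where
  isMildSolution : IsMildSolution T g h v s xs τ x
  maximal : ∀ (τ' : EReal) (x' : ℝ → X), τ < τ' → IsMildSolution T g h v s xs τ' x' →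
    ¬ EqOn x' x (timeInterval s τ)

end Semigroups

end ISpSMild

/-!
The argument rests on an energy estimate which works directly for mild solutions. If `x` is a mild
solution with forcing bounded by `M`, expanding `‖x z‖²` for `z` slightly larger than `t` in the
Duhamel formula restarted at `t` bounds the upper right Dini derivative of `‖x‖²` by
`-2ω‖x‖² + 2⟪x, g x⟫ + 2M‖x‖`; the point is that `‖T ε (x t)‖ ≤ exp (-ω ε) ‖x t‖` while the averages
of `T (z - r) (g (x r))` over `[t, z]` converge to `g (x t)`. With the dissipativity of `g` and
Young's inequality, Gronwall's lemma gives the input-to-state bound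
`‖x t‖ ≤ exp (-κ t) ‖x 0‖ + √(2C / (ω - ω')) + M / (ω - ω')` with `κ = (ω - ω') / 2`
(`IsMildOn.frequently_slope_lt`, `IsMildOn.sq_norm_le`, `IsMildOn.norm_le`).

Uniqueness, and Lipschitz dependence on the initial value, follow from the integral form of
Gronwall's inequality (`IsMildOn.norm_sub_le`). For existence, `g` is composed with the radial
retraction onto a large ball. The truncated term is globally Lipschitz, so a weighted contraction
argument gives a global solution (`exists_isMildOn_of_lipschitzWith`), and it is still dissipative
with an arbitrarily small loss (`inner_comp_radialProj_le`), so the energy estimate keeps that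
solution inside the ball, where the truncation is invisible (`exists_isMildOn`). Blow-up
alternatives are thereby avoided. The semiprocess laws are uniqueness applied to restarted and
time-shifted solutions.

For the zero input, the bound above yields a bounded absorbing ball. The solution at time `1` is
`T ε` applied to a bounded quantity, up to an error of order `ε`, so the compactness of `T ε` makes
the time-one image of the ball totally bounded (`totallyBounded_image_of_isMildOn`). The ω-limit
set of the ball is then the attractor (`exists_compact_attracting`). Since the attractor is bounded
and nonempty, the input-to-state bound for the norm is, up to an additive constant, the required
one for the distance to the attractor.
-/

namespace ISpSMild

/-! ### Strongly continuous contraction semigroups and Duhamel integrals -/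

section Duhamel

variable {X : Type*} [NormedAddCommGroup X] [NormedSpace ℝ X] {T : ℝ → X →L[ℝ] X}

theorem norm_semigroup_apply_le (hb : ∀ t : ℝ, 0 ≤ t → ‖T t‖ ≤ 1) {t : ℝ} (ht : 0 ≤ t) (x : X) :
    ‖T t x‖ ≤ ‖x‖ := by
  simpa using (T t).le_of_opNorm_le (hb t ht) x

/-- A strongly continuous contraction semigroup, extended by the identity to negative times, is
jointly continuous in time and space. -/
theorem IsC0Semigroup.continuous_max (hT : IsC0Semigroup T) (hb : ∀ t : ℝ, 0 ≤ t → ‖T t‖ ≤ 1) :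
    Continuous fun p : ℝ × X => T (max p.1 0) p.2 := by
  rw [continuous_iff_continuousAt]
  rintro ⟨t₀, x₀⟩
  have h1 : Continuous fun t : ℝ => T (max t 0) x₀ :=
    (hT.continuousOn x₀).comp_continuous (continuous_id.max continuous_const)
      fun t => le_max_right t 0
  refine tendsto_iff_norm_sub_tendsto_zero.2 ?_
  have h2 : Tendsto (fun p : ℝ × X => ‖p.2 - x₀‖ + ‖T (max p.1 0) x₀ - T (max t₀ 0) x₀‖)
      (𝓝 (t₀, x₀)) (𝓝 0) := by
    have : Continuous
        (fun p : ℝ × X => ‖p.2 - x₀‖ + ‖T (max p.1 0) x₀ - T (max t₀ 0) x₀‖) := by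
      have := h1.comp (continuous_fst (X := ℝ) (Y := X))
      exact (continuous_snd.sub continuous_const).norm.add (this.sub continuous_const).norm
    have := this.tendsto (t₀, x₀)
    simpa using this
  refine squeeze_zero (fun _ => norm_nonneg _) (fun p => ?_) h2
  have : T (max p.1 0) p.2 - T (max t₀ 0) x₀
      = T (max p.1 0) (p.2 - x₀) + (T (max p.1 0) x₀ - T (max t₀ 0) x₀) := by
    rw [map_sub]; abel
  rw [this]
  refine (norm_add_le _ _).trans ?_
  gcongr
  exact norm_semigroup_apply_le hb (le_max_right _ _) _

theorem IsC0Semigroup.aestronglyMeasurable_max (hT : IsC0Semigroup T)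
    (hb : ∀ t : ℝ, 0 ≤ t → ‖T t‖ ≤ 1) {f : ℝ → X} {μ : Measure ℝ} (hf : AEStronglyMeasurable f μ)
    (t : ℝ) : AEStronglyMeasurable (fun r => T (max (t - r) 0) (f r)) μ :=
  (hT.continuous_max hb).comp_aestronglyMeasurable
    ((continuous_const.sub continuous_id).aestronglyMeasurable.prodMk hf)

theorem IsC0Semigroup.intervalIntegrable_max (hT : IsC0Semigroup T)
    (hb : ∀ t : ℝ, 0 ≤ t → ‖T t‖ ≤ 1) {f : ℝ → X} {a b : ℝ} (t : ℝ)
    (hf : IntervalIntegrable f volume a b) :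
    IntervalIntegrable (fun r => T (max (t - r) 0) (f r)) volume a b :=
  hf.mono_fun (hT.aestronglyMeasurable_max hb hf.def'.aestronglyMeasurable t)
    (Eventually.of_forall fun _ => norm_semigroup_apply_le hb (le_max_right _ _) _)

theorem IsC0Semigroup.intervalIntegrable (hT : IsC0Semigroup T)
    (hb : ∀ t : ℝ, 0 ≤ t → ‖T t‖ ≤ 1) {f : ℝ → X} {a b t : ℝ} (hab : a ≤ b) (hbt : b ≤ t)
    (hf : IntervalIntegrable f volume a b) :
    IntervalIntegrable (fun r => T (t - r) (f r)) volume a b := by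
  refine (hT.intervalIntegrable_max hb t hf).congr ?_
  intro r hr
  rw [uIoc_of_le hab] at hr
  simp only
  rw [max_eq_left (by linarith [hr.2])]

theorem norm_duhamel_le (hb : ∀ t : ℝ, 0 ≤ t → ‖T t‖ ≤ 1) {f : ℝ → X} {a b t : ℝ} {φ : ℝ → ℝ}
    (hab : a ≤ b) (hbt : b ≤ t) (hf : ∀ᵐ r, r ∈ Ioc a b → ‖f r‖ ≤ φ r)
    (hφ : IntervalIntegrable φ volume a b) :
    ‖∫ r in a..b, T (t - r) (f r)‖ ≤ ∫ r in a..b, φ r := by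
  refine intervalIntegral.norm_integral_le_of_norm_le hab ?_ hφ
  filter_upwards [hf] with r hr hm
  exact (norm_semigroup_apply_le hb (by linarith [hm.2]) _).trans (hr hm)

theorem norm_duhamel_le_const (hb : ∀ t : ℝ, 0 ≤ t → ‖T t‖ ≤ 1) {f : ℝ → X} {a b t M : ℝ}
    (hab : a ≤ b) (hbt : b ≤ t) (hf : ∀ᵐ r, r ∈ Ioc a b → ‖f r‖ ≤ M) :
    ‖∫ r in a..b, T (t - r) (f r)‖ ≤ M * (b - a) := by
  refine (norm_duhamel_le hb hab hbt hf intervalIntegrable_const).trans (le_of_eq ?_)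
  simp [mul_comm]

/-- Restarting a Duhamel integral at an intermediate time. -/
theorem IsC0Semigroup.duhamel_split [CompleteSpace X] (hT : IsC0Semigroup T)
    (hb : ∀ t : ℝ, 0 ≤ t → ‖T t‖ ≤ 1) {f : ℝ → X} {s t t' : ℝ} (hst : s ≤ t) (htt : t ≤ t')
    (hf : IntervalIntegrable f volume s t') :
    ∫ r in s..t', T (t' - r) (f r)
      = T (t' - t) (∫ r in s..t, T (t - r) (f r)) + ∫ r in t..t', T (t' - r) (f r) := by
  have hf1 : IntervalIntegrable f volume s t :=
    hf.mono_set (by rw [uIcc_of_le hst, uIcc_of_le (hst.trans htt)]; exact Icc_subset_Icc_right htt)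
  have hf2 : IntervalIntegrable f volume t t' :=
    hf.mono_set (by rw [uIcc_of_le htt, uIcc_of_le (hst.trans htt)]; exact Icc_subset_Icc_left hst)
  rw [← ContinuousLinearMap.intervalIntegral_comp_comm _ (hT.intervalIntegrable hb hst le_rfl hf1),
    ← intervalIntegral.integral_add_adjacent_intervals
      (hT.intervalIntegrable hb hst htt hf1) (hT.intervalIntegrable hb htt le_rfl hf2)]
  congr 1
  refine intervalIntegral.integral_congr fun r hr => ?_
  rw [uIcc_of_le hst] at hr
  have := hT.add (t' - t) (t - r) (by linarith) (by linarith [hr.2])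
  rw [sub_add_sub_cancel] at this
  simp [this]

theorem IsC0Semigroup.continuousOn_duhamel [CompleteSpace X] (hT : IsC0Semigroup T)
    (hb : ∀ t : ℝ, 0 ≤ t → ‖T t‖ ≤ 1) {f : ℝ → X} {s : ℝ}
    (hf : ∀ t, s ≤ t → IntervalIntegrable f volume s t) :
    ContinuousOn (fun t => ∫ r in s..t, T (t - r) (f r)) (Ici s) := by
  intro t₀ ht₀
  have ht₀' : s ≤ t₀ := ht₀
  set F : ℝ → ℝ → X := fun t r => T (max (t - r) 0) ((Ioi s).indicator f r) with hF
  -- extending `f` by zero makes `s` and `t₀` interior points of an interval of integrability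
  have hint : IntervalIntegrable ((Ioi s).indicator f) volume (s - 1) (t₀ + 1) := by
    rw [intervalIntegrable_iff, uIoc_of_le (by linarith)]
    have h1 := hf (t₀ + 1) (by linarith)
    rw [intervalIntegrable_iff, uIoc_of_le (by linarith)] at h1
    have h2 : IntegrableOn ((Ioi s).indicator f) (Ioc s (t₀ + 1)) :=
      h1.congr_fun (fun r hr => (indicator_of_mem (show r ∈ Ioi s from hr.1) f).symm)
        measurableSet_Ioc
    have h3 : IntegrableOn ((Ioi s).indicator f) (Ioc (s - 1) s) :=
      (integrableOn_zero (ε' := X)).congr_fun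
        (fun r hr => (indicator_of_notMem (by simpa using hr.2) f).symm) measurableSet_Ioc
    have := h3.union h2
    rwa [Ioc_union_Ioc_eq_Ioc (by linarith) (by linarith)] at this
  have key : ContinuousAt (fun p : ℝ × ℝ => ∫ r in s..p.2, F p.1 r) (t₀, t₀) := by
    refine intervalIntegral.continuousAt_parametric_primitive_of_dominated
      (fun r => ‖(Ioi s).indicator f r‖) (s - 1) (t₀ + 1)
      (fun t => hT.aestronglyMeasurable_max hb hint.def'.aestronglyMeasurable t) ?_ hint.norm ?_
      ⟨by linarith, by linarith⟩ ⟨by linarith, by linarith⟩ (by simp)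
    · exact Eventually.of_forall fun t => Eventually.of_forall fun r =>
        norm_semigroup_apply_le hb (le_max_right _ _) _
    · refine Eventually.of_forall fun r => ?_
      have h1 : Continuous fun t : ℝ => (t - r, (Ioi s).indicator f r) := by fun_prop
      exact ((hT.continuous_max hb).comp h1).continuousAt
  have key2 : ContinuousAt (fun t => ∫ r in s..t, F t r) t₀ :=
    ContinuousAt.comp (f := fun t : ℝ => (t, t)) key (by fun_prop)
  refine key2.continuousWithinAt.congr (fun t ht => ?_) ?_
  all_goals
    refine intervalIntegral.integral_congr_ae (Eventually.of_forall fun r hr => ?_)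
    rw [uIoc_of_le (by assumption)] at hr
    simp only [hF]
    rw [max_eq_left (by linarith [hr.2]), indicator_of_mem (show r ∈ Ioi s from hr.1)]

end Duhamel

/-! ### Mild solutions: restarting, Gronwall estimates, uniqueness -/

/-- The integral form of Gronwall's inequality. -/
theorem le_mul_exp_of_le_add_integral {φ : ℝ → ℝ} {a K s b : ℝ} (hK : 0 ≤ K)
    (hφ : ContinuousOn φ (Icc s b))
    (h : ∀ t ∈ Icc s b, φ t ≤ a + K * ∫ r in s..t, φ r) :
    ∀ t ∈ Icc s b, φ t ≤ a * Real.exp (K * (t - s)) := by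
  intro t ht
  have hsb : s ≤ b := ht.1.trans ht.2
  set ψ : ℝ → ℝ := IccExtend hsb (fun x => φ x) with hψ
  have hψc : Continuous ψ := (continuousOn_iff_continuous_domRestrict.1 hφ).Icc_extend'
  have hψφ : ∀ r ∈ Icc s b, ψ r = φ r := fun r hr => IccExtend_of_mem hsb (fun x => φ x) hr
  have hint : ∀ t ∈ Icc s b, ∫ r in s..t, φ r = ∫ r in s..t, ψ r := by
    intro t ht
    refine intervalIntegral.integral_congr fun r hr => ?_
    rw [uIcc_of_le ht.1] at hr
    exact (hψφ r ⟨hr.1, hr.2.trans ht.2⟩).symm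
  have hd : ∀ t, HasDerivAt (fun t => a + K * ∫ r in s..t, ψ r) (K * ψ t) t := fun t =>
    ((intervalIntegral.integral_hasDerivAt_right (hψc.intervalIntegrable _ _)
      (hψc.stronglyMeasurableAtFilter _ _) hψc.continuousAt).const_mul K).const_add a
  have key := le_gronwallBound_of_liminf_deriv_right_le (f := fun t => a + K * ∫ r in s..t, ψ r)
    (f' := fun t => K * ψ t) (δ := a) (K := K) (ε := 0) (a := s) (b := b)
    (fun t _ => (hd t).continuousAt.continuousWithinAt)
    (fun t _ ρ hρ => (hd t).hasDerivWithinAt.liminf_right_slope_le hρ) (by simp)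
    (fun t ht => by
      have ht' : t ∈ Icc s b := ⟨ht.1, ht.2.le⟩
      have := h t ht'
      rw [hint t ht', ← hψφ t ht'] at this
      rw [add_zero]
      exact mul_le_mul_of_nonneg_left this hK) t ht
  rw [gronwallBound_ε0] at key
  have := h t ht
  rw [hint t ht] at this
  exact this.trans key

theorem continuous_of_lipschitzOnWith_bounded {X : Type*} [NormedAddCommGroup X] {g : X → X}
    (hg : ∀ B : Set X, Bornology.IsBounded B → ∃ K : ℝ≥0, LipschitzOnWith K g B) :
    Continuous g := by
  refine continuous_iff_continuousAt.2 fun x => ?_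
  obtain ⟨K, hK⟩ := hg (Metric.ball x 1) Metric.isBounded_ball
  exact hK.continuousOn.continuousAt (Metric.ball_mem_nhds x one_pos)

section Mild

variable {X : Type*} [NormedAddCommGroup X] [NormedSpace ℝ X] {T : ℝ → X →L[ℝ] X}
  {g : X → X} {f : ℝ → X} {s b : ℝ} {xs ys : X} {x y : ℝ → X} {J : Set ℝ}

/-- `x` is a mild solution of `x' = A x + g(x) + f`, `x(s) = xs`, on the set of times `J`, where
`A` generates `T`. The reaction and forcing terms are collected in one integral. -/
structure IsMildOn (T : ℝ → X →L[ℝ] X) (g : X → X) (f : ℝ → X) (s : ℝ) (xs : X) (J : Set ℝ)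
    (x : ℝ → X) : Prop where
  continuousOn : ContinuousOn x J
  eq : ∀ t ∈ J, x t = T (t - s) xs + ∫ r in s..t, T (t - r) (g (x r) + f r)

theorem IsMildOn.mono {J' : Set ℝ} (hx : IsMildOn T g f s xs J x) (h : J' ⊆ J) :
    IsMildOn T g f s xs J' x :=
  ⟨hx.continuousOn.mono h, fun t ht => hx.eq t (h ht)⟩

theorem IsMildOn.initial (hT : IsC0Semigroup T) (hx : IsMildOn T g f s xs J x) (hs : s ∈ J) :
    x s = xs := by
  simpa [hT.zero] using hx.eq s hs

theorem IsMildOn.intervalIntegrable (hx : IsMildOn T g f s xs (Icc s b) x) (hgc : Continuous g)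
    {a t : ℝ} (hsa : s ≤ a) (hat : a ≤ t) (htb : t ≤ b) :
    IntervalIntegrable (fun r => g (x r)) volume a t := by
  refine ContinuousOn.intervalIntegrable (hgc.comp_continuousOn (hx.continuousOn.mono ?_))
  rw [uIcc_of_le hat]
  exact Icc_subset_Icc hsa htb

theorem IsMildSolution.isMildOn {U : Type*} [NormedAddCommGroup U] [NormedSpace ℝ U]
    {h : U →L[ℝ] X} {v : ℝ → U} {τ : EReal} (hT : IsC0Semigroup T)
    (hb : ∀ t : ℝ, 0 ≤ t → ‖T t‖ ≤ 1) (hgc : Continuous g)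
    (hv : ∀ t, s ≤ t → IntervalIntegrable (fun r => h (v r)) volume s t)
    (hx : IsMildSolution T g h v s xs τ x) (hbτ : b ∈ timeInterval s τ) :
    IsMildOn T g (fun r => h (v r)) s xs (Icc s b) x := by
  have hsub : Icc s b ⊆ timeInterval s τ := fun t ht =>
    ⟨ht.1, lt_of_le_of_lt (EReal.coe_le_coe_iff.2 ht.2) hbτ.2⟩
  have hc := hx.continuousOn.mono hsub
  refine ⟨hc, fun t ht => ?_⟩
  have h1 : IntervalIntegrable (fun r => g (x r)) volume s t := by
    refine ContinuousOn.intervalIntegrable (hgc.comp_continuousOn (hc.mono ?_))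
    rw [uIcc_of_le ht.1]
    exact Icc_subset_Icc_right ht.2
  rw [hx.eq t (hsub ht), add_assoc, ← intervalIntegral.integral_add
    (hT.intervalIntegrable hb ht.1 le_rfl h1) (hT.intervalIntegrable hb ht.1 le_rfl (hv t ht.1))]
  simp only [map_add]

theorem IsMildOn.isMildSolution {U : Type*} [NormedAddCommGroup U] [NormedSpace ℝ U]
    {h : U →L[ℝ] X} {v : ℝ → U} (hT : IsC0Semigroup T)
    (hb : ∀ t : ℝ, 0 ≤ t → ‖T t‖ ≤ 1) (hgc : Continuous g)
    (hv : ∀ t, s ≤ t → IntervalIntegrable (fun r => h (v r)) volume s t)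
    (hx : IsMildOn T g (fun r => h (v r)) s xs (Ici s) x) :
    IsMildSolution T g h v s xs ⊤ x := by
  have hI : timeInterval s ⊤ = Ici s := by
    ext t; simp [timeInterval, EReal.coe_lt_top]
  refine ⟨EReal.coe_lt_top s, by rw [hI]; exact hx.continuousOn, fun t ht => ?_⟩
  rw [hI] at ht
  have h1 := (hx.mono (Icc_subset_Ici_self : Icc s t ⊆ Ici s)).intervalIntegrable hgc le_rfl ht
    le_rfl
  rw [hx.eq t ht, add_assoc, ← intervalIntegral.integral_add
    (hT.intervalIntegrable hb ht le_rfl h1) (hT.intervalIntegrable hb ht le_rfl (hv t ht))]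
  simp only [map_add]

/-- A mild solution, restarted at time `a` from its value there, satisfies the Duhamel formula. -/
theorem IsMildOn.restart_eq [CompleteSpace X] (hT : IsC0Semigroup T)
    (hb : ∀ t : ℝ, 0 ≤ t → ‖T t‖ ≤ 1) (hgc : Continuous g)
    (hf : ∀ t, s ≤ t → IntervalIntegrable f volume s t)
    (hx : IsMildOn T g f s xs (Icc s b) x) {a t : ℝ} (hsa : s ≤ a) (hat : a ≤ t) (htb : t ≤ b) :
    x t = T (t - a) (x a) + ∫ r in a..t, T (t - r) (g (x r) + f r) := by
  have hst := hsa.trans hat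
  have hint : IntervalIntegrable (fun r => g (x r) + f r) volume s t :=
    (hx.intervalIntegrable hgc le_rfl hst htb).add (hf t hst)
  rw [hx.eq t ⟨hst, htb⟩, hx.eq a ⟨hsa, hat.trans htb⟩, hT.duhamel_split hb hsa hat hint, map_add,
    ← add_assoc]
  congr 2
  have := hT.add (t - a) (a - s) (by linarith) (by linarith)
  rw [sub_add_sub_cancel] at this
  simp [this]

theorem IsMildOn.restart [CompleteSpace X] (hT : IsC0Semigroup T)
    (hb : ∀ t : ℝ, 0 ≤ t → ‖T t‖ ≤ 1) (hgc : Continuous g)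
    (hf : ∀ t, s ≤ t → IntervalIntegrable f volume s t)
    (hx : IsMildOn T g f s xs (Ici s) x) {a : ℝ} (hsa : s ≤ a) :
    IsMildOn T g f a (x a) (Ici a) x :=
  ⟨hx.continuousOn.mono (Ici_subset_Ici.2 hsa), fun t ht =>
    (hx.mono (Icc_subset_Ici_self : Icc s t ⊆ Ici s)).restart_eq hT hb hgc hf hsa ht le_rfl⟩

/-- A time shift of the solution corresponds to a time shift of the forcing. -/
theorem IsMildOn.shift {f' : ℝ → X} {τ : ℝ}
    (hx : IsMildOn T g f (s + τ) xs (Ici (s + τ)) x)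
    (hf' : ∀ᵐ r, s ≤ r → f' r = f (r + τ)) :
    IsMildOn T g f' s xs (Ici s) (fun t => x (t + τ)) := by
  refine ⟨hx.continuousOn.comp (by fun_prop) fun t ht => ?_, fun t ht => ?_⟩
  · exact add_le_add_left (show s ≤ t from ht) τ
  · have ht' : s ≤ t := ht
    rw [hx.eq (t + τ) (add_le_add_left ht' τ), add_sub_add_right_eq_sub,
      ← intervalIntegral.integral_comp_add_right]
    congr 1
    refine intervalIntegral.integral_congr_ae ?_
    filter_upwards [hf'] with r hr hm
    rw [uIoc_of_le ht'] at hm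
    rw [hr hm.1.le, add_sub_add_right_eq_sub]

theorem IsMildOn.norm_sub_le (hT : IsC0Semigroup T)
    (hb : ∀ t : ℝ, 0 ≤ t → ‖T t‖ ≤ 1) (hgc : Continuous g)
    (hf : ∀ t, s ≤ t → IntervalIntegrable f volume s t)
    (hx : IsMildOn T g f s xs (Icc s b) x) (hy : IsMildOn T g f s ys (Icc s b) y)
    {B : Set X} {K : ℝ≥0} (hK : LipschitzOnWith K g B) (hxB : ∀ t ∈ Icc s b, x t ∈ B)
    (hyB : ∀ t ∈ Icc s b, y t ∈ B) :
    ∀ t ∈ Icc s b, ‖x t - y t‖ ≤ ‖xs - ys‖ * Real.exp (K * (t - s)) := by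
  have hc : ContinuousOn (fun t => ‖x t - y t‖) (Icc s b) :=
    (hx.continuousOn.sub hy.continuousOn).norm
  refine le_mul_exp_of_le_add_integral K.2 hc fun t ht => ?_
  have h1 : IntervalIntegrable (fun r => g (x r) + f r) volume s t :=
    (hx.intervalIntegrable hgc le_rfl ht.1 ht.2).add (hf t ht.1)
  have h2 : IntervalIntegrable (fun r => g (y r) + f r) volume s t :=
    (hy.intervalIntegrable hgc le_rfl ht.1 ht.2).add (hf t ht.1)
  have h3 : x t - y t = T (t - s) (xs - ys) + ∫ r in s..t, T (t - r) (g (x r) - g (y r)) := by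
    rw [hx.eq t ht, hy.eq t ht, add_sub_add_comm, ← map_sub, ← intervalIntegral.integral_sub
      (hT.intervalIntegrable hb ht.1 le_rfl h1) (hT.intervalIntegrable hb ht.1 le_rfl h2)]
    simp only [← map_sub, add_sub_add_right_eq_sub]
  rw [h3, ← intervalIntegral.integral_const_mul]
  refine (norm_add_le _ _).trans (add_le_add
    (norm_semigroup_apply_le hb (by linarith [ht.1]) _) ?_)
  refine norm_duhamel_le hb ht.1 le_rfl (Eventually.of_forall fun r hr => ?_) ?_
  · have hr' : r ∈ Icc s b := ⟨hr.1.le, hr.2.trans ht.2⟩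
    simpa [dist_eq_norm] using hK.dist_le_mul _ (hxB r hr') _ (hyB r hr')
  · refine ContinuousOn.intervalIntegrable ?_
    rw [uIcc_of_le ht.1]
    exact continuousOn_const.mul (hc.mono (Icc_subset_Icc_right ht.2))

theorem IsMildOn.unique (hT : IsC0Semigroup T)
    (hb : ∀ t : ℝ, 0 ≤ t → ‖T t‖ ≤ 1)
    (hg : ∀ B : Set X, Bornology.IsBounded B → ∃ K : ℝ≥0, LipschitzOnWith K g B)
    (hf : ∀ t, s ≤ t → IntervalIntegrable f volume s t)
    (hx : IsMildOn T g f s xs (Icc s b) x) (hy : IsMildOn T g f s xs (Icc s b) y) :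
    EqOn x y (Icc s b) := by
  have hB : Bornology.IsBounded (x '' Icc s b ∪ y '' Icc s b) :=
    (isCompact_Icc.image_of_continuousOn hx.continuousOn).isBounded.union
      (isCompact_Icc.image_of_continuousOn hy.continuousOn).isBounded
  obtain ⟨K, hK⟩ := hg _ hB
  intro t ht
  have := hx.norm_sub_le hT hb (continuous_of_lipschitzOnWith_bounded hg) hf hy hK
    (fun t ht => Or.inl (mem_image_of_mem x ht)) (fun t ht => Or.inr (mem_image_of_mem y ht)) t ht
  rw [sub_self, norm_zero, zero_mul] at this
  exact sub_eq_zero.1 (norm_le_zero_iff.1 this)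

end Mild

/-! ### The energy estimate -/

section Energy

variable {X : Type*} [NormedAddCommGroup X] [NormedSpace ℝ X] {T : ℝ → X →L[ℝ] X}

/-- The averages of `r ↦ T (z - r) (k r)` over `[t, z]` converge to `k t` as `z ↓ t`. -/
theorem IsC0Semigroup.tendsto_average [CompleteSpace X] (hT : IsC0Semigroup T)
    (hb : ∀ t : ℝ, 0 ≤ t → ‖T t‖ ≤ 1) {k : ℝ → X} {t b : ℝ} (htb : t < b)
    (hk : ContinuousOn k (Icc t b)) :
    Tendsto (fun z => (z - t)⁻¹ • ∫ r in t..z, T (z - r) (k r)) (𝓝[>] t) (𝓝 (k t)) := by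
  have h1 : Tendsto (fun p : ℝ × ℝ => T (max p.1 0) (k p.2)) (𝓝 0 ×ˢ 𝓝[Icc t b] t)
      (𝓝 (k t)) := by
    have h2 : Tendsto (fun p : ℝ × ℝ => (p.1, k p.2)) (𝓝 0 ×ˢ 𝓝[Icc t b] t) (𝓝 (0, k t)) := by
      rw [nhds_prod_eq]
      exact tendsto_fst.prodMk ((hk t (left_mem_Icc.2 htb.le)).tendsto.comp tendsto_snd)
    have h3 := ((hT.continuous_max hb).tendsto (0, k t)).comp h2
    simpa [Function.comp_def, hT.zero] using h3
  rw [Metric.tendsto_nhds]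
  intro η hη
  have h2 := h1.eventually (Metric.closedBall_mem_nhds (k t) (half_pos hη))
  obtain ⟨P, hP, Q, hQ, hPQ⟩ := eventually_prod_iff.1 h2
  obtain ⟨δ₁, hδ₁, h1'⟩ := Metric.eventually_nhds_iff.1 hP
  obtain ⟨δ₂, hδ₂, h2'⟩ := Metric.eventually_nhds_iff.1 (eventually_nhdsWithin_iff.1 hQ)
  have hpos : 0 < min (b - t) (min δ₁ δ₂) := lt_min (by linarith) (lt_min hδ₁ hδ₂)
  filter_upwards [Ioo_mem_nhdsGT (show t < t + min (b - t) (min δ₁ δ₂) by linarith)] with z hz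
  have hz1 : z - t < b - t := by linarith [hz.2, min_le_left (b - t) (min δ₁ δ₂)]
  have hz2 : z - t < min δ₁ δ₂ := by linarith [hz.2, min_le_right (b - t) (min δ₁ δ₂)]
  have hz3 : z - t < δ₁ := hz2.trans_le (min_le_left _ _)
  have hz4 : z - t < δ₂ := hz2.trans_le (min_le_right _ _)
  have hzt : 0 < z - t := by linarith [hz.1]
  have hint : IntervalIntegrable (fun r => T (z - r) (k r)) volume t z := by
    refine hT.intervalIntegrable hb hz.1.le le_rfl (ContinuousOn.intervalIntegrable ?_)
    rw [uIcc_of_le hz.1.le]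
    exact hk.mono (Icc_subset_Icc_right (by linarith))
  have h5 : ‖∫ r in t..z, (T (z - r) (k r) - k t)‖ ≤ η / 2 * |z - t| := by
    refine intervalIntegral.norm_integral_le_of_norm_le_const fun r hr => ?_
    rw [uIoc_of_le hz.1.le] at hr
    have h6 := hPQ (h1' (y := z - r) (by
        rw [Real.dist_eq, sub_zero, abs_of_nonneg (by linarith [hr.2])]; linarith [hr.1]))
      (h2' (y := r) (by
        rw [Real.dist_eq, abs_of_nonneg (by linarith [hr.1])]; linarith [hr.2])
        ⟨hr.1.le, by linarith [hr.2]⟩)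
    simp only at h6
    rwa [max_eq_left (by linarith [hr.2]), dist_eq_norm] at h6
  rw [intervalIntegral.integral_sub hint intervalIntegrable_const,
    intervalIntegral.integral_const, abs_of_pos hzt] at h5
  rw [dist_eq_norm]
  have h7 : (z - t)⁻¹ • (∫ r in t..z, T (z - r) (k r)) - k t
      = (z - t)⁻¹ • ((∫ r in t..z, T (z - r) (k r)) - (z - t) • k t) := by
    rw [smul_sub, smul_smul, inv_mul_cancel₀ hzt.ne', one_smul]
  rw [h7, norm_smul, norm_inv, Real.norm_of_nonneg hzt.le]
  calc (z - t)⁻¹ * _ ≤ (z - t)⁻¹ * (η / 2 * (z - t)) := by gcongr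
    _ = η / 2 := by field_simp
    _ < η := half_lt_self hη

end Energy

section EnergyInner

variable {X : Type*} [NormedAddCommGroup X] [InnerProductSpace ℝ X] [CompleteSpace X]
  {T : ℝ → X →L[ℝ] X} {g : X → X} {f : ℝ → X} {s b ω : ℝ} {xs : X} {x : ℝ → X}

/-- Along a mild solution, the upper right Dini derivative of `‖x‖²` is at most
`-2ω‖x‖² + 2⟪x, g x⟫ + 2M‖x‖`, where `M` bounds the forcing. -/
theorem IsMildOn.frequently_slope_lt (hT : IsC0Semigroup T) (hω : 0 < ω)
    (hTω : ∀ t : ℝ, 0 ≤ t → ‖T t‖ ≤ Real.exp (-ω * t)) (hgc : Continuous g)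
    (hf : ∀ t, s ≤ t → IntervalIntegrable f volume s t) {M : ℝ}
    (hfM : ∀ᵐ r, s ≤ r → ‖f r‖ ≤ M) (hx : IsMildOn T g f s xs (Icc s b) x)
    {t : ℝ} (ht : t ∈ Ico s b) {ρ : ℝ}
    (hρ : -2 * ω * ‖x t‖ ^ 2 + 2 * inner ℝ (x t) (g (x t)) + 2 * M * ‖x t‖ < ρ) :
    ∃ᶠ z in 𝓝[>] t, (z - t)⁻¹ * (‖x z‖ ^ 2 - ‖x t‖ ^ 2) < ρ := by
  have hb : ∀ t : ℝ, 0 ≤ t → ‖T t‖ ≤ 1 := fun t ht =>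
    (hTω t ht).trans (Real.exp_le_one_iff.2 (by nlinarith))
  set p : ℝ → X := fun z => T (z - t) (x t) with hp
  set I : ℝ → X := fun z => ∫ r in t..z, T (z - r) (g (x r)) with hI
  set q : ℝ → X := fun z => (z - t)⁻¹ • I z with hq
  set e : ℝ → ℝ := fun z => (z - t)⁻¹ * (Real.exp (-2 * ω * (z - t)) - 1) with he
  have hqt : Tendsto q (𝓝[>] t) (𝓝 (g (x t))) :=
    hT.tendsto_average hb ht.2
      (hgc.comp_continuousOn (hx.continuousOn.mono (Icc_subset_Icc_left ht.1)))
  have hpt : Tendsto p (𝓝[>] t) (𝓝 (x t)) := by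
    have h1 : Continuous fun z : ℝ => (z - t, x t) := by fun_prop
    have h2 := ((hT.continuous_max hb).comp h1).tendsto t
    simp only [Function.comp_def, sub_self, max_self, hT.zero,
      ContinuousLinearMap.id_apply] at h2
    refine (h2.mono_left nhdsWithin_le_nhds).congr' ?_
    filter_upwards [self_mem_nhdsWithin] with z hz
    rw [max_eq_left (sub_nonneg.2 (le_of_lt hz))]
  have het : Tendsto e (𝓝[>] t) (𝓝 (-2 * ω)) := by
    have h1 : HasDerivAt (fun z => Real.exp (-2 * ω * (z - t))) (-2 * ω) t := by
      have := ((((hasDerivAt_id t).sub_const t).const_mul (-2 * ω))).exp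
      simpa using this
    have h2 := hasDerivAt_iff_tendsto_slope.1 h1
    refine (h2.mono_left (nhdsWithin_mono t fun z hz => ne_of_gt hz)).congr fun z => ?_
    simp [slope_def_field, he, div_eq_inv_mul]
  have hst : Tendsto (fun z : ℝ => z - t) (𝓝[>] t) (𝓝 0) := by
    have : Continuous fun z : ℝ => z - t := by fun_prop
    simpa using (this.tendsto t).mono_left nhdsWithin_le_nhds
  have hH : Tendsto (fun z => e z * ‖x t‖ ^ 2 + 2 * inner ℝ (p z) (q z) + 2 * M * ‖x t‖
      + (z - t) * (‖q z‖ + M) ^ 2) (𝓝[>] t)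
      (𝓝 (-2 * ω * ‖x t‖ ^ 2 + 2 * inner ℝ (x t) (g (x t)) + 2 * M * ‖x t‖)) := by
    have := (((het.mul_const (‖x t‖ ^ 2)).add ((hpt.inner (𝕜 := ℝ) hqt).const_mul 2)).add_const
      (2 * M * ‖x t‖)).add (hst.mul ((hqt.norm.add_const M).pow 2))
    simpa using this
  refine Eventually.frequently ?_
  filter_upwards [hH.eventually_lt_const hρ, Ioo_mem_nhdsGT ht.2] with z hz hzt
  refine lt_of_le_of_lt ?_ hz
  have hε : 0 < z - t := sub_pos.2 hzt.1
  set J : X := ∫ r in t..z, T (z - r) (f r) with hJ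
  have hf2 : IntervalIntegrable f volume t z := by
    refine (hf z (ht.1.trans hzt.1.le)).mono_set ?_
    rw [uIcc_of_le hzt.1.le, uIcc_of_le (ht.1.trans hzt.1.le)]
    exact Icc_subset_Icc_left ht.1
  have hxz : x z = p z + ((z - t) • q z + J) := by
    rw [hx.restart_eq hT hb hgc hf ht.1 hzt.1.le hzt.2.le]
    congr 1
    have h1 := hx.intervalIntegrable hgc ht.1 hzt.1.le hzt.2.le
    simp only [map_add]
    rw [intervalIntegral.integral_add (hT.intervalIntegrable hb hzt.1.le le_rfl h1)
      (hT.intervalIntegrable hb hzt.1.le le_rfl hf2)]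
    simp only [hq, hI, smul_smul, mul_inv_cancel₀ hε.ne', one_smul, hJ]
  have hJn : ‖J‖ ≤ M * (z - t) := by
    refine norm_duhamel_le_const hb hzt.1.le le_rfl ?_
    filter_upwards [hfM] with r hr hm
    exact hr (ht.1.trans hm.1.le)
  have hpn : ‖p z‖ ^ 2 ≤ Real.exp (-2 * ω * (z - t)) * ‖x t‖ ^ 2 := by
    have h1 : ‖p z‖ ≤ Real.exp (-ω * (z - t)) * ‖x t‖ :=
      (T (z - t)).le_of_opNorm_le (hTω _ hε.le) _
    calc ‖p z‖ ^ 2 ≤ (Real.exp (-ω * (z - t)) * ‖x t‖) ^ 2 := by gcongr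
      _ = _ := by rw [mul_pow, ← Real.exp_nat_mul]; congr 2; push_cast; ring
  have hpn' : ‖p z‖ ≤ ‖x t‖ := norm_semigroup_apply_le hb hε.le _
  have hpJ : inner ℝ (p z) J ≤ ‖x t‖ * (M * (z - t)) :=
    (real_inner_le_norm _ _).trans (by gcongr)
  have hIJ : ‖(z - t) • q z + J‖ ≤ (z - t) * (‖q z‖ + M) := by
    refine (norm_add_le _ _).trans ?_
    rw [norm_smul, Real.norm_of_nonneg hε.le]
    linarith
  have hIJ2 : ‖(z - t) • q z + J‖ ^ 2 ≤ ((z - t) * (‖q z‖ + M)) ^ 2 := by gcongr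
  have key : ‖x z‖ ^ 2 - ‖x t‖ ^ 2 ≤ (z - t) * (e z * ‖x t‖ ^ 2 + 2 * inner ℝ (p z) (q z)
      + 2 * M * ‖x t‖ + (z - t) * (‖q z‖ + M) ^ 2) := by
    have he' : (z - t) * e z = Real.exp (-2 * ω * (z - t)) - 1 := by
      simp only [he]; rw [← mul_assoc, mul_inv_cancel₀ hε.ne', one_mul]
    rw [hxz, norm_add_sq_real, inner_add_right, real_inner_smul_right]
    calc _ ≤ Real.exp (-2 * ω * (z - t)) * ‖x t‖ ^ 2
          + 2 * ((z - t) * inner ℝ (p z) (q z) + ‖x t‖ * (M * (z - t)))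
          + ((z - t) * (‖q z‖ + M)) ^ 2 - ‖x t‖ ^ 2 := by linarith
      _ = _ := by linear_combination (-‖x t‖ ^ 2) * he'
  calc (z - t)⁻¹ * (‖x z‖ ^ 2 - ‖x t‖ ^ 2) ≤ (z - t)⁻¹ * ((z - t) * _) := by gcongr
    _ = _ := by rw [← mul_assoc, inv_mul_cancel₀ hε.ne', one_mul]

/-- A priori bound for mild solutions with dissipative reaction term. -/
theorem IsMildOn.sq_norm_le (hT : IsC0Semigroup T) (hω : 0 < ω)
    (hTω : ∀ t : ℝ, 0 ≤ t → ‖T t‖ ≤ Real.exp (-ω * t)) (hgc : Continuous g)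
    {C ω' : ℝ} (hC : 0 ≤ C) (hω' : ω' < ω)
    (hgC : ∀ x : X, inner ℝ x (g x) ≤ C + ω' * ‖x‖ ^ 2)
    (hf : ∀ t, s ≤ t → IntervalIntegrable f volume s t) {M : ℝ}
    (hfM : ∀ᵐ r, s ≤ r → ‖f r‖ ≤ M) (hx : IsMildOn T g f s xs (Icc s b) x) :
    ∀ t ∈ Icc s b, ‖x t‖ ^ 2 ≤ ‖xs‖ ^ 2 * Real.exp (-(ω - ω') * (t - s))
      + (2 * C + M ^ 2 / (ω - ω')) / (ω - ω') := by
  intro t ht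
  have hδ : 0 < ω - ω' := sub_pos.2 hω'
  set δ := ω - ω' with hδdef
  have hsb : s ∈ Icc s b := ⟨le_rfl, ht.1.trans ht.2⟩
  have key := le_gronwallBound_of_liminf_deriv_right_le (f := fun t => ‖x t‖ ^ 2)
    (f' := fun t => -2 * ω * ‖x t‖ ^ 2 + 2 * inner ℝ (x t) (g (x t)) + 2 * M * ‖x t‖)
    (δ := ‖xs‖ ^ 2) (K := -δ) (ε := 2 * C + M ^ 2 / δ) (a := s) (b := b)
    (hx.continuousOn.norm.pow 2)
    (fun t ht ρ hρ => hx.frequently_slope_lt hT hω hTω hgc hf hfM ht hρ)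
    (by rw [hx.initial hT hsb])
    (fun t _ => by
      have h1 := hgC (x t)
      -- Young's inequality absorbs the forcing into half of the dissipation
      have h2 : 2 * M * ‖x t‖ ≤ δ * ‖x t‖ ^ 2 + M ^ 2 / δ := by
        have : 0 ≤ (δ * ‖x t‖ - M) ^ 2 / δ := by positivity
        have h3 : (δ * ‖x t‖ - M) ^ 2 / δ = δ * ‖x t‖ ^ 2 - 2 * M * ‖x t‖ + M ^ 2 / δ := by
          field_simp; ring
        linarith
      have h4 : δ * ‖x t‖ ^ 2 = ω * ‖x t‖ ^ 2 - ω' * ‖x t‖ ^ 2 := by rw [hδdef]; ring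
      linarith) t ht
  rw [gronwallBound_of_K_ne_0 (by linarith)] at key
  refine key.trans (add_le_add_right ?_ _)
  have h5 : 0 ≤ (2 * C + M ^ 2 / δ) / δ := by positivity
  have h6 : 0 < Real.exp (-δ * (t - s)) := Real.exp_pos _
  rw [div_neg, neg_mul]
  nlinarith

end EnergyInner

/-! ### Global existence of mild solutions -/

section Lipschitz

variable {X : Type*} [NormedAddCommGroup X] [NormedSpace ℝ X] [CompleteSpace X]
  {T : ℝ → X →L[ℝ] X} {f : ℝ → X} {s : ℝ}

omit [CompleteSpace X] in
theorem exp_mul_norm_duhamel_le (hb : ∀ t : ℝ, 0 ≤ t → ‖T t‖ ≤ 1) {c l t : ℝ} (hc : 0 ≤ c)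
    (hl : 0 < l) (hst : s ≤ t) (hf : ∀ᵐ r, r ∈ Ioc s t → ‖f r‖ ≤ c * Real.exp (l * (r - s))) :
    Real.exp (-l * (t - s)) * ‖∫ r in s..t, T (t - r) (f r)‖ ≤ c / l := by
  have hd : ∀ r, HasDerivAt (fun r => c / l * Real.exp (l * (r - s)))
      (c * Real.exp (l * (r - s))) r := fun r => by
    have h1 := ((((hasDerivAt_id r).sub_const s).const_mul l).exp).const_mul (c / l)
    refine h1.congr_deriv ?_
    simp only [id]; field_simp
  have hcont : Continuous fun r => c * Real.exp (l * (r - s)) := by fun_prop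
  have h2 := norm_duhamel_le hb hst le_rfl hf (hcont.intervalIntegrable _ _)
  rw [intervalIntegral.integral_eq_sub_of_hasDerivAt (fun r _ => hd r)
    (hcont.intervalIntegrable _ _)] at h2
  have h3 : Real.exp (-l * (t - s)) * Real.exp (l * (t - s)) = 1 := by
    rw [← Real.exp_add]; simp
  have h4 : 0 ≤ c / l * Real.exp (l * (s - s)) := by positivity
  calc _ ≤ Real.exp (-l * (t - s)) * (c / l * Real.exp (l * (t - s))) := by
        gcongr; linarith
    _ = c / l * (Real.exp (-l * (t - s)) * Real.exp (l * (t - s))) := by ring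
    _ = c / l := by rw [h3, mul_one]

/-- For a globally Lipschitz reaction term, mild solutions exist globally: the Duhamel operator is
a contraction of the bounded continuous functions once the solution is weighted by
`exp (-l * (t - s))` with `l` large. -/
theorem exists_isMildOn_of_lipschitzWith (hT : IsC0Semigroup T)
    (hb : ∀ t : ℝ, 0 ≤ t → ‖T t‖ ≤ 1) {G : X → X} {K : ℝ≥0} (hG : LipschitzWith K G)
    (hf : ∀ t, s ≤ t → IntervalIntegrable f volume s t) {M : ℝ} (hM : 0 ≤ M)
    (hfM : ∀ᵐ r, s ≤ r → ‖f r‖ ≤ M) (xs : X) : ∃ x, IsMildOn T G f s xs (Ici s) x := by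
  -- the Lipschitz constant of the weighted Duhamel operator is at most `K / l ≤ 1 / 2`
  set l : ℝ := 2 * (K + 1) with hl
  have hK : (0 : ℝ) ≤ K := K.2
  have hlpos : 0 < l := by positivity
  set y : BoundedContinuousFunction ℝ X → ℝ → X := fun z r => Real.exp (l * (r - s)) • z r with hy
  have hyc : ∀ z, Continuous (y z) := fun z => by
    have := z.continuous
    simp only [hy]; fun_prop
  have hGy : ∀ z t, s ≤ t → IntervalIntegrable (fun r => G (y z r) + f r) volume s t :=
    fun z t ht => ((hG.continuous.comp (hyc z)).intervalIntegrable _ _).add (hf t ht)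
  set F : BoundedContinuousFunction ℝ X → ℝ → X := fun z t =>
    T (t - s) xs + ∫ r in s..t, T (t - r) (G (y z r) + f r) with hF
  have hFc : ∀ z, ContinuousOn (F z) (Ici s) := fun z => by
    refine ContinuousOn.add ?_ (hT.continuousOn_duhamel hb (hGy z))
    exact (hT.continuousOn xs).comp (by fun_prop) fun t ht => sub_nonneg.2 (show s ≤ t from ht)
  have hcont : ∀ z, Continuous fun t => Real.exp (-l * (max t s - s)) • F z (max t s) := fun z => by
    refine Continuous.smul (by fun_prop) ?_
    exact (hFc z).comp_continuous (by fun_prop) fun t => le_max_right t s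
  have hbound : ∀ z t, ‖Real.exp (-l * (max t s - s)) • F z (max t s)‖
      ≤ ‖xs‖ + (K * ‖z‖ + ‖G 0‖ + M) / l := fun z t => by
    set m := max t s
    have hm : s ≤ m := le_max_right _ _
    rw [norm_smul, Real.norm_of_nonneg (Real.exp_pos _).le]
    have h1 : ‖T (m - s) xs‖ ≤ ‖xs‖ := norm_semigroup_apply_le hb (sub_nonneg.2 hm) _
    have h2 : Real.exp (-l * (m - s)) ≤ 1 := Real.exp_le_one_iff.2 (by nlinarith)
    have h3 := exp_mul_norm_duhamel_le (f := fun r => G (y z r) + f r) hb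
      (c := K * ‖z‖ + ‖G 0‖ + M) (by positivity) hlpos hm (by
        filter_upwards [hfM] with r hr hrm
        have h4 : 1 ≤ Real.exp (l * (r - s)) :=
          Real.one_le_exp (mul_nonneg hlpos.le (by linarith [hrm.1]))
        have h5 : ‖G (y z r)‖ ≤ K * (Real.exp (l * (r - s)) * ‖z‖) + ‖G 0‖ := by
          have h6 := hG.dist_le_mul (y z r) 0
          rw [dist_eq_norm, dist_zero_right] at h6
          have h7 : ‖y z r‖ ≤ Real.exp (l * (r - s)) * ‖z‖ := by
            simp only [hy, norm_smul, Real.norm_of_nonneg (Real.exp_pos _).le]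
            gcongr
            exact z.norm_coe_le_norm r
          have h8 : ‖G (y z r)‖ ≤ ‖G (y z r) - G 0‖ + ‖G 0‖ := by
            simpa using norm_add_le (G (y z r) - G 0) (G 0)
          have : (K : ℝ) * ‖y z r‖ ≤ K * (Real.exp (l * (r - s)) * ‖z‖) := by gcongr
          linarith
        have h9 := norm_add_le (G (y z r)) (f r)
        have h10 := hr hrm.1.le
        have h11 : ‖G 0‖ + M ≤ (‖G 0‖ + M) * Real.exp (l * (r - s)) :=
          le_mul_of_one_le_right (by positivity) h4
        linarith)
    calc _ ≤ Real.exp (-l * (m - s)) * (‖T (m - s) xs‖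
            + ‖∫ r in s..m, T (m - r) (G (y z r) + f r)‖) := by
          gcongr; exact norm_add_le _ _
      _ = Real.exp (-l * (m - s)) * ‖T (m - s) xs‖
            + Real.exp (-l * (m - s)) * ‖∫ r in s..m, T (m - r) (G (y z r) + f r)‖ := by ring
      _ ≤ 1 * ‖xs‖ + (K * ‖z‖ + ‖G 0‖ + M) / l := by gcongr
      _ = _ := by rw [one_mul]
  set Φ : BoundedContinuousFunction ℝ X → BoundedContinuousFunction ℝ X := fun z =>
    BoundedContinuousFunction.ofNormedAddCommGroup _ (hcont z) _ (hbound z) with hΦ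
  have hΦa : ∀ z t, Φ z t = Real.exp (-l * (max t s - s)) • F z (max t s) := fun z t => rfl
  have hcontr : ContractingWith (1 / 2) Φ := by
    refine ⟨by rw [← NNReal.coe_lt_coe]; norm_num, LipschitzWith.of_dist_le_mul fun z w => ?_⟩
    rw [BoundedContinuousFunction.dist_le (by positivity)]
    intro t
    rw [hΦa, hΦa, dist_eq_norm, ← smul_sub, norm_smul, Real.norm_of_nonneg (Real.exp_pos _).le]
    set m := max t s
    have hm : s ≤ m := le_max_right _ _
    have h1 : F z m - F w m = ∫ r in s..m, T (m - r) (G (y z r) - G (y w r)) := by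
      simp only [hF]
      rw [add_sub_add_left_eq_sub, ← intervalIntegral.integral_sub
        (hT.intervalIntegrable hb hm le_rfl (hGy z m hm))
        (hT.intervalIntegrable hb hm le_rfl (hGy w m hm))]
      simp only [← map_sub, add_sub_add_right_eq_sub]
    rw [h1]
    refine (exp_mul_norm_duhamel_le hb (c := K * dist z w) (by positivity) hlpos hm
      (Eventually.of_forall fun r _ => ?_)).trans ?_
    · have h2 := hG.dist_le_mul (y z r) (y w r)
      rw [dist_eq_norm, dist_eq_norm] at h2
      refine h2.trans ?_
      rw [mul_assoc]
      gcongr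
      simp only [hy]
      rw [← smul_sub, norm_smul, Real.norm_of_nonneg (Real.exp_pos _).le, mul_comm]
      gcongr
      rw [← dist_eq_norm]
      exact BoundedContinuousFunction.dist_coe_le_dist r
    · rw [div_le_iff₀ hlpos]
      have : (0 : ℝ) ≤ dist z w := dist_nonneg
      push_cast
      rw [hl]
      linarith
  obtain ⟨z, hz⟩ : ∃ z, Φ z = z := ⟨_, hcontr.fixedPoint_isFixedPt⟩
  refine ⟨y z, (hyc z).continuousOn, fun t ht => ?_⟩
  have ht' : s ≤ t := ht
  have h1 : z t = Real.exp (-l * (t - s)) • F z t := by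
    have := hΦa z t
    rwa [hz, max_eq_left ht'] at this
  have h2 : Real.exp (l * (t - s)) * Real.exp (-l * (t - s)) = 1 := by
    rw [← Real.exp_add]; simp
  calc y z t = Real.exp (l * (t - s)) • z t := rfl
    _ = F z t := by rw [h1, smul_smul, h2, one_smul]

end Lipschitz

section Truncation

variable {X : Type*} [NormedAddCommGroup X]

/-- The radial retraction onto the closed ball of radius `R > 0`. -/
noncomputable def radialProj [NormedSpace ℝ X] (R : ℝ) (x : X) : X := (R / max R ‖x‖) • x

theorem radialProj_of_norm_le [NormedSpace ℝ X] {R : ℝ} (hR : 0 < R) {x : X} (hx : ‖x‖ ≤ R) :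
    radialProj R x = x := by
  rw [radialProj, max_eq_left hx, div_self hR.ne', one_smul]

theorem norm_radialProj_le [NormedSpace ℝ X] {R : ℝ} (hR : 0 < R) (x : X) :
    ‖radialProj R x‖ ≤ R := by
  have hm : 0 < max R ‖x‖ := lt_max_of_lt_left hR
  rw [radialProj, norm_smul, Real.norm_of_nonneg (by positivity), div_mul_eq_mul_div,
    div_le_iff₀ hm]
  exact mul_le_mul_of_nonneg_left (le_max_right _ _) hR.le

theorem lipschitzWith_radialProj [NormedSpace ℝ X] {R : ℝ} (hR : 0 < R) :
    LipschitzWith 2 (radialProj R : X → X) := by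
  refine LipschitzWith.of_dist_le_mul fun x y => ?_
  rw [dist_eq_norm, dist_eq_norm]
  set m := max R ‖x‖ with hm
  set n := max R ‖y‖ with hn
  have hmpos : 0 < m := lt_max_of_lt_left hR
  have hnpos : 0 < n := lt_max_of_lt_left hR
  have h1 : radialProj R x - radialProj R y = (R / m) • (x - y) + (R / m - R / n) • y := by
    simp only [radialProj, ← hm, ← hn]
    rw [smul_sub, sub_smul]; abel
  have h2 : |R / m - R / n| * ‖y‖ ≤ ‖x - y‖ := by
    have h3 : R / m - R / n = R / m * ((n - m) / n) := by field_simp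
    have h4 : |n - m| ≤ ‖x - y‖ := by
      have := abs_max_sub_max_le_abs ‖y‖ ‖x‖ R
      rw [max_comm _ R, max_comm _ R] at this
      refine this.trans ?_
      rw [norm_sub_rev]
      exact abs_norm_sub_norm_le y x
    rw [h3, abs_mul, abs_of_nonneg (show 0 ≤ R / m by positivity), abs_div, abs_of_pos hnpos]
    have h5 : R / m ≤ 1 := (div_le_one hmpos).2 (le_max_left _ _)
    have h6 : ‖y‖ / n ≤ 1 := (div_le_one hnpos).2 (le_max_right _ _)
    calc R / m * (|n - m| / n) * ‖y‖ = R / m * |n - m| * (‖y‖ / n) := by ring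
      _ ≤ 1 * ‖x - y‖ * 1 := by gcongr
      _ = ‖x - y‖ := by ring
  rw [h1]
  refine (norm_add_le _ _).trans ?_
  rw [norm_smul, norm_smul, Real.norm_of_nonneg (show 0 ≤ R / m by positivity), Real.norm_eq_abs]
  have h5 : R / m ≤ 1 := (div_le_one hmpos).2 (le_max_left _ _)
  have h7 : R / m * ‖x - y‖ ≤ 1 * ‖x - y‖ := by gcongr
  push_cast
  linarith

/-- Truncating the reaction term radially degrades the dissipation rate only by `C / R ^ 2`. -/
theorem inner_comp_radialProj_le [InnerProductSpace ℝ X] {g : X → X} {C ω' R : ℝ} (hC : 0 ≤ C)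
    (hω' : 0 ≤ ω') (hgC : ∀ x : X, inner ℝ x (g x) ≤ C + ω' * ‖x‖ ^ 2) (hR : 0 < R) (x : X) :
    inner ℝ x (g (radialProj R x)) ≤ C + (ω' + C / R ^ 2) * ‖x‖ ^ 2 := by
  set m := max R ‖x‖ with hm
  have hmpos : 0 < m := lt_max_of_lt_left hR
  have h1 : x = (m / R) • radialProj R x := by
    rw [radialProj, ← hm, smul_smul, div_mul_div_cancel₀ hR.ne', div_self hmpos.ne', one_smul]
  have h2 : inner ℝ x (g (radialProj R x))
      = m / R * inner ℝ (radialProj R x) (g (radialProj R x)) := by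
    conv_lhs => rw [h1, real_inner_smul_left, ← h1]
  have h3 : ‖radialProj R x‖ = R / m * ‖x‖ := by
    rw [radialProj, norm_smul, Real.norm_of_nonneg (by positivity)]
  have h4 := hgC (radialProj R x)
  have h5 : R / m ≤ 1 := (div_le_one hmpos).2 (le_max_left _ _)
  have h6 : m / R ≤ 1 + ‖x‖ ^ 2 / R ^ 2 := by
    rw [← div_pow]
    rcases le_total ‖x‖ R with h | h
    · rw [hm, max_eq_left h, div_self hR.ne']
      have : 0 ≤ (‖x‖ / R) ^ 2 := by positivity
      linarith
    · rw [hm, max_eq_right h]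
      nlinarith [sq_nonneg (‖x‖ / R - 1)]
  calc inner ℝ x (g (radialProj R x)) ≤ m / R * (C + ω' * ‖radialProj R x‖ ^ 2) := by
        rw [h2]; gcongr
    _ = m / R * C + ω' * (R / m * ‖x‖ ^ 2) := by rw [h3]; field_simp
    _ ≤ (1 + ‖x‖ ^ 2 / R ^ 2) * C + ω' * (1 * ‖x‖ ^ 2) := by gcongr
    _ = _ := by ring

end Truncation

/-- Global existence of mild solutions. The equation is solved with the reaction term truncated at
a radius `R` which is larger than the a priori bound for the truncated equation. -/
theorem exists_isMildOn {X : Type*} [NormedAddCommGroup X] [InnerProductSpace ℝ X]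
    [CompleteSpace X] {T : ℝ → X →L[ℝ] X} {g : X → X} {f : ℝ → X} {s ω C ω' M : ℝ}
    (hT : IsC0Semigroup T) (hω : 0 < ω)
    (hTω : ∀ t : ℝ, 0 ≤ t → ‖T t‖ ≤ Real.exp (-ω * t))
    (hg : ∀ B : Set X, Bornology.IsBounded B → ∃ K : ℝ≥0, LipschitzOnWith K g B)
    (hC : 0 ≤ C) (hω'0 : 0 ≤ ω') (hω' : ω' < ω)
    (hgC : ∀ x : X, inner ℝ x (g x) ≤ C + ω' * ‖x‖ ^ 2)
    (hf : ∀ t, s ≤ t → IntervalIntegrable f volume s t) (hM : 0 ≤ M)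
    (hfM : ∀ᵐ r, s ≤ r → ‖f r‖ ≤ M) (xs : X) :
    ∃ x, IsMildOn T g f s xs (Ici s) x := by
  have hb : ∀ t : ℝ, 0 ≤ t → ‖T t‖ ≤ 1 := fun t ht =>
    (hTω t ht).trans (Real.exp_le_one_iff.2 (by nlinarith))
  -- half of the dissipation rate is given up to the truncation, which needs `C / R ^ 2 ≤ δ`;
  -- `Q` is the resulting a priori bound for `‖x t‖ ^ 2`, so `R ^ 2 ≥ Q` is needed as well
  set δ := (ω - ω') / 2 with hδdef
  have hδ : 0 < δ := by rw [hδdef]; linarith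
  set Q := ‖xs‖ ^ 2 + (2 * C + M ^ 2 / δ) / δ with hQ
  have hQ0 : 0 ≤ Q := by positivity
  have hCδ : 0 ≤ C / δ := by positivity
  set R := Real.sqrt (Q + C / δ + 1) with hRdef
  have hR2 : R ^ 2 = Q + C / δ + 1 := Real.sq_sqrt (by positivity)
  have hR : 0 < R := Real.sqrt_pos.2 (by positivity)
  obtain ⟨K, hK⟩ := hg (Metric.closedBall 0 R) Metric.isBounded_closedBall
  have hG : LipschitzWith (K * 2) (fun x => g (radialProj R x)) := by
    have := hK.comp ((lipschitzWith_radialProj (X := X) hR).lipschitzOnWith (s := univ))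
      fun x _ => by simpa using norm_radialProj_le hR x
    exact lipschitzOnWith_univ.1 this
  have hGC : ∀ x : X, inner ℝ x (g (radialProj R x)) ≤ C + (ω - δ) * ‖x‖ ^ 2 := fun x => by
    refine (inner_comp_radialProj_le hC hω'0 hgC hR x).trans ?_
    have h1 : C / R ^ 2 ≤ δ := by
      rw [div_le_iff₀ (by positivity), hR2]
      have : δ * (C / δ) = C := by field_simp
      nlinarith
    have h2 : ω' + C / R ^ 2 ≤ ω - δ := by rw [hδdef] at h1 ⊢; linarith
    gcongr
  obtain ⟨x, hx⟩ := exists_isMildOn_of_lipschitzWith hT hb hG hf hM hfM xs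
  have hxR : ∀ t, s ≤ t → ‖x t‖ ≤ R := fun t ht => by
    have h1 := (hx.mono (Icc_subset_Ici_self : Icc s t ⊆ Ici s)).sq_norm_le hT hω hTω
      hG.continuous hC (sub_lt_self ω hδ) hGC hf hfM t (right_mem_Icc.2 ht)
    rw [sub_sub_cancel] at h1
    have h2 : Real.exp (-δ * (t - s)) ≤ 1 := Real.exp_le_one_iff.2 (by nlinarith)
    have h3 : ‖xs‖ ^ 2 * Real.exp (-δ * (t - s)) ≤ ‖xs‖ ^ 2 :=
      mul_le_of_le_one_right (by positivity) h2
    exact abs_le_of_sq_le_sq' (by linarith) hR.le |>.2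
  refine ⟨x, hx.continuousOn, fun t ht => ?_⟩
  have ht' : s ≤ t := ht
  rw [hx.eq t ht]
  congr 1
  refine intervalIntegral.integral_congr fun r hr => ?_
  rw [uIcc_of_le ht'] at hr
  rw [radialProj_of_norm_le hR (hxR r hr.1)]

/-! ### Compactness and attractors -/

/-- If the semigroup is compact, the time-one map of bounded families of mild solutions has totally
bounded range: for small `ε` the solution at time `1` differs from `T ε (x (1 - ε))` by `O(ε)`. -/
theorem totallyBounded_image_of_isMildOn {X : Type*} [NormedAddCommGroup X] [NormedSpace ℝ X]
    [CompleteSpace X] {T : ℝ → X →L[ℝ] X} {g : X → X} {f : ℝ → X} {M R : ℝ}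
    (hT : IsC0Semigroup T) (hcomp : IsCompactSemigroup T) (hb : ∀ t : ℝ, 0 ≤ t → ‖T t‖ ≤ 1)
    (hg : ∀ B : Set X, Bornology.IsBounded B → ∃ K : ℝ≥0, LipschitzOnWith K g B)
    (hf : ∀ t, 0 ≤ t → IntervalIntegrable f volume 0 t) (hM : 0 ≤ M)
    (hfM : ∀ᵐ r, 0 ≤ r → ‖f r‖ ≤ M) {B : Set X} {x : X → ℝ → X}
    (hx : ∀ x₀ ∈ B, IsMildOn T g f 0 x₀ (Icc 0 1) (x x₀))
    (hxR : ∀ x₀ ∈ B, ∀ t ∈ Icc (0 : ℝ) 1, ‖x x₀ t‖ ≤ R) :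
    TotallyBounded ((fun x₀ => x x₀ 1) '' B) := by
  have hgc := continuous_of_lipschitzOnWith_bounded hg
  obtain ⟨K, hK⟩ := hg (Metric.closedBall 0 R) Metric.isBounded_closedBall
  obtain ⟨G, hG0, hG⟩ : ∃ G : ℝ, 0 ≤ G ∧ ∀ y : X, ‖y‖ ≤ R → ‖g y‖ ≤ G := by
    refine ⟨K * |R| + ‖g 0‖, by positivity, fun y hy => ?_⟩
    have hR0 : 0 ≤ R := (norm_nonneg y).trans hy
    have h1 := hK.dist_le_mul y (by simpa using hy) 0 (by simpa using hR0)
    rw [dist_eq_norm, dist_zero_right] at h1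
    have h2 : ‖g y‖ ≤ ‖g y - g 0‖ + ‖g 0‖ := by simpa using norm_add_le (g y - g 0) (g 0)
    have h3 : (K : ℝ) * ‖y‖ ≤ K * |R| := by gcongr; exact hy.trans (le_abs_self R)
    linarith
  rw [Metric.totallyBounded_iff]
  intro η hη
  -- `(G + M) * ε` bounds the Duhamel integral over `[1 - ε, 1]`
  set ε := min (1 / 2) (η / (2 * (G + M + 1))) with hε
  have hεpos : 0 < ε := lt_min (by norm_num) (by positivity)
  have hε1 : ε ≤ 1 / 2 := min_le_left _ _
  have hε2 : (G + M) * ε < η / 2 := by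
    have h1 : ε ≤ η / (2 * (G + M + 1)) := min_le_right _ _
    rw [le_div_iff₀ (by positivity)] at h1
    linarith
  have hTB : TotallyBounded (T ε '' Metric.closedBall 0 R) :=
    ((hcomp ε hεpos).isCompact_closure_image_closedBall R).totallyBounded.subset subset_closure
  obtain ⟨F, hF, hcov⟩ := Metric.totallyBounded_iff.1 hTB (η / 2) (half_pos hη)
  refine ⟨F, hF, ?_⟩
  rintro _ ⟨x₀, hx₀, rfl⟩
  have hm : T ε (x x₀ (1 - ε)) ∈ T ε '' Metric.closedBall 0 R :=
    mem_image_of_mem _ (by simpa using hxR x₀ hx₀ (1 - ε) ⟨by linarith, by linarith⟩)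
  obtain ⟨p, hp, hpd⟩ := mem_iUnion₂.1 (hcov hm)
  refine mem_iUnion₂.2 ⟨p, hp, ?_⟩
  have h1 := (hx x₀ hx₀).restart_eq hT hb hgc hf (a := 1 - ε) (t := 1) (by linarith) (by linarith)
    le_rfl
  rw [sub_sub_cancel] at h1
  have h2 : ‖∫ r in (1 - ε)..1, T (1 - r) (g (x x₀ r) + f r)‖ ≤ (G + M) * (1 - (1 - ε)) := by
    refine norm_duhamel_le_const hb (by linarith) le_rfl ?_
    filter_upwards [hfM] with r hr hrm
    have hr0 : 0 ≤ r := by linarith [hrm.1]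
    exact (norm_add_le _ _).trans (add_le_add (hG _ (hxR x₀ hx₀ r ⟨hr0, hrm.2⟩)) (hr hr0))
  rw [sub_sub_cancel] at h2
  have h3 : dist (x x₀ 1) (T ε (x x₀ (1 - ε))) ≤ (G + M) * ε := by
    rw [dist_eq_norm, h1, add_sub_cancel_left]; exact h2
  have h4 := dist_triangle (x x₀ 1) (T ε (x x₀ (1 - ε))) p
  rw [Metric.mem_ball] at hpd ⊢
  linarith

/-- A continuous semigroup with a bounded absorbing set `B` whose time-one image is relatively
compact has a compact attracting set `Θ` with `Θ ⊆ ϕ t '' Θ`, namely the ω-limit set of `B`. -/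
theorem exists_compact_attracting {X : Type*} [MetricSpace X] {ϕ : ℝ → X → X}
    (hc : ∀ t, 0 ≤ t → Continuous (ϕ t))
    (hadd : ∀ s t x, 0 ≤ s → 0 ≤ t → ϕ (s + t) x = ϕ t (ϕ s x)) {B : Set X}
    (hB : Bornology.IsBounded B)
    (habs : ∀ B' : Set X, Bornology.IsBounded B' → ∃ t₀, 0 ≤ t₀ ∧ ∀ t, t₀ ≤ t →
      MapsTo (ϕ t) B' B)
    (hK : IsCompact (closure (ϕ 1 '' B))) :
    ∃ Θ : Set X, IsCompact Θ ∧
      (∀ B' : Set X, Bornology.IsBounded B' → ∀ ε > 0, ∀ᶠ t in atTop,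
        MapsTo (ϕ t) B' (Metric.thickening ε Θ)) ∧
      ∀ t, 0 ≤ t → Θ ⊆ ϕ t '' Θ := by
  set Θ := omegaLimit atTop ϕ B with hΘ
  have hev : ∀ᶠ t in atTop, MapsTo (ϕ t) B (closure (ϕ 1 '' B)) := by
    obtain ⟨t₀, ht₀, h⟩ := habs B hB
    filter_upwards [eventually_ge_atTop (t₀ + 1)] with t ht x hx
    have h1 := hadd (t - 1) 1 x (by linarith) zero_le_one
    rw [sub_add_cancel] at h1
    rw [h1]
    exact subset_closure (mem_image_of_mem _ (h (t - 1) (by linarith) hx))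
  have hopen : ∀ n : Set X, IsOpen n → Θ ⊆ n → ∀ᶠ t in atTop, MapsTo (ϕ t) B n := fun n hn hΘn =>
    eventually_mapsTo_of_isCompact_absorbing_of_isOpen_of_omegaLimit_subset atTop ϕ B hK hev hn hΘn
  have hΘc : IsCompact Θ := by
    refine hK.of_isClosed_subset (isClosed_omegaLimit _ _ _) ?_
    refine (omegaLimit_subset_closure_image2 _ _ _ hev).trans (closure_minimal ?_ isClosed_closure)
    exact image2_subset_iff.2 fun t ht x hx => ht hx
  refine ⟨Θ, hΘc, fun B' hB' ε hε => ?_, fun t ht y hy => ?_⟩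
  · obtain ⟨t₀, ht₀, h⟩ := habs B' hB'
    have h1 := hopen _ Metric.isOpen_thickening (Metric.self_subset_thickening hε Θ)
    have h2 := (tendsto_atTop_add_const_right atTop (-t₀) tendsto_id).eventually h1
    filter_upwards [h2, eventually_ge_atTop t₀] with t ht htt x hx
    have h3 := hadd t₀ (t - t₀) x ht₀ (by linarith)
    rw [add_sub_cancel] at h3
    rw [h3]
    exact ht (h t₀ le_rfl hx)
  · -- otherwise some closed ball around `y` is avoided by `ϕ t '' Θ`, hence eventually by the orbits
    by_contra hyt
    have hcl : IsClosed (ϕ t '' Θ) := (hΘc.image (hc t ht)).isClosed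
    obtain ⟨ε, hε, hball⟩ := Metric.nhds_basis_closedBall.mem_iff.1 (hcl.isOpen_compl.mem_nhds hyt)
    have h1 := hopen (ϕ t ⁻¹' (Metric.closedBall y ε)ᶜ)
      (Metric.isClosed_closedBall.isOpen_compl.preimage (hc t ht))
      fun θ hθ hm => hball hm (mem_image_of_mem _ hθ)
    have h2 : ∀ᶠ r in atTop, MapsTo (ϕ r) B (Metric.closedBall y ε)ᶜ := by
      have h3 := (tendsto_atTop_add_const_right atTop (-t) tendsto_id).eventually h1
      filter_upwards [h3, eventually_ge_atTop t] with r hr hrt x hx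
      have h4 := hadd (r - t) t x (by linarith) ht
      rw [sub_add_cancel] at h4
      rw [h4]
      exact hr hx
    have h5 := omegaLimit_subset_closure_image2 atTop ϕ B h2 hy
    obtain ⟨z, hz, hyz⟩ := Metric.mem_closure_iff.1 h5 ε hε
    obtain ⟨r, hr, x, hx, rfl⟩ := hz
    exact hr hx (Metric.mem_closedBall'.2 hyz.le)

/-- Every global attractor is contained in every other one. -/
theorem IsGlobalAttractor.subset {X I : Type*} [NormedAddCommGroup X] {S : I → ℝ → ℝ → X → X}
    {V : Set I} {Θ Θ' : Set X} (h : IsGlobalAttractor S V Θ) (h' : IsGlobalAttractor S V Θ') :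
    Θ' ⊆ Θ := by
  intro y hy
  rw [← h.isCompact.isClosed.closure_eq, Metric.mem_closure_iff_infEDist_zero]
  refine le_antisymm (ge_of_tendsto (h.attractive Θ' h'.isCompact.isBounded) ?_) zero_le
  filter_upwards [eventually_ge_atTop 0] with t ht
  exact le_iSup₂_of_le y (h'.negInvariant t ht hy) le_rfl

/-! ### Inputs -/

section Inputs

variable {U : Type*} [NormedAddCommGroup U]

theorem ae_norm_le_norm_LInfty (u : LInfty U) : ∀ᵐ r, 0 ≤ r → ‖u r‖ ≤ ‖u‖ := by
  have h1 : ∀ᵐ r ∂halfLine, ‖u r‖ ≤ ‖u‖ := by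
    filter_upwards [ae_le_eLpNormEssSup (f := u) (μ := halfLine)] with t ht
    rw [Lp.norm_def, eLpNorm_exponent_top]
    have hfin : eLpNormEssSup u halfLine ≠ ∞ := by
      have := Lp.eLpNorm_ne_top u
      rwa [eLpNorm_exponent_top] at this
    simpa using ENNReal.toReal_mono hfin ht
  exact (ae_restrict_iff' measurableSet_Ici).1 h1

theorem intervalIntegrable_LInfty (u : LInfty U) {s t : ℝ} (hs : 0 ≤ s) (hst : s ≤ t) :
    IntervalIntegrable u volume s t := by
  rw [intervalIntegrable_iff, uIoc_of_le hst]
  refine Measure.integrableOn_of_bounded (M := ‖u‖) (by simp)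
    (Lp.stronglyMeasurable u).aestronglyMeasurable ?_
  refine (ae_restrict_iff' measurableSet_Ioc).2 ?_
  filter_upwards [ae_norm_le_norm_LInfty u] with r hr hm
  exact hr (hs.trans hm.1.le)

theorem ae_translate_eq (τ : ℝ≥0) (u : LInfty U) : ∀ᵐ r, 0 ≤ r → translate τ u r = u (r + τ) :=
  (ae_restrict_iff' measurableSet_Ici).1 (memLp_translate τ u).coeFn_toLp

theorem translate_zero (τ : ℝ≥0) : translate τ (0 : LInfty U) = 0 := by
  refine Lp.ext ?_
  have h0 : ∀ᵐ r ∂halfLine, (0 : LInfty U) r = 0 := Lp.coeFn_zero U ∞ halfLine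
  filter_upwards [(memLp_translate τ (0 : LInfty U)).coeFn_toLp, h0,
    (quasiMeasurePreserving_add τ).ae h0] with r h1 h2 h3
  rw [translate, h1, h2, h3]

theorem IsCompactStep.translate {f : ℝ → U} (hf : IsCompactStep f) {τ : ℝ} (hτ : 0 ≤ τ) :
    IsCompactStep fun r => f (r + τ) := by
  obtain ⟨m, t, ht0, hmono, hconst, hzero⟩ := hf
  by_cases htm : t m ≤ τ
  · exact ⟨0, fun _ => 0, rfl, by simp, by simp, fun r hr => hzero _ (by linarith)⟩
  · push Not at htm
    -- `j + 1` is the first index with `τ < t (j + 1)`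
    obtain ⟨j, hj, hjm, hj'⟩ : ∃ j, t j ≤ τ ∧ j < m ∧ τ < t (j + 1) := by
      classical
      have hex : ∃ k, τ < t k := ⟨m, htm⟩
      have hk0 : Nat.find hex ≠ 0 := fun h => by
        have := Nat.find_spec hex
        rw [h, ht0] at this
        linarith
      obtain ⟨j, hj⟩ := Nat.exists_eq_succ_of_ne_zero hk0
      refine ⟨j, not_lt.1 (Nat.find_min hex (by omega)), ?_, ?_⟩
      · have := Nat.find_min' hex htm
        omega
      · have := Nat.find_spec hex
        rwa [hj] at this
    obtain ⟨p, hp0, hp⟩ : ∃ p : ℕ → ℝ, p 0 = 0 ∧ ∀ i, p (i + 1) = t (j + (i + 1)) - τ :=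
      ⟨fun i => if i = 0 then 0 else t (j + i) - τ, rfl, fun _ => rfl⟩
    refine ⟨m - j, p, hp0, fun i hi => ?_, fun i hi => ?_, fun r hr => ?_⟩
    · cases i with
      | zero =>
        rw [hp0, hp]
        exact sub_pos.2 hj'
      | succ i =>
        rw [hp, hp]
        exact sub_lt_sub_right (hmono _ (by omega)) _
    · obtain ⟨c, hc⟩ := hconst (j + i) (by omega)
      refine ⟨c, fun r hr => hc _ ⟨?_, ?_⟩⟩
      · cases i with
        | zero =>
          rw [hp0] at hr
          rw [add_zero]
          linarith [hr.1]
        | succ i =>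
          rw [hp i] at hr
          linarith [hr.1]
      · rw [hp i] at hr
        exact lt_sub_iff_add_lt.1 hr.2
    · obtain ⟨i, hi⟩ := Nat.exists_eq_succ_of_ne_zero (Nat.sub_ne_zero_of_lt hjm)
      rw [hi, hp, ← Nat.succ_eq_add_one, ← hi, Nat.add_sub_cancel' hjm.le] at hr
      exact hzero _ (by linarith)

theorem mapsTo_translate_SInfty (τ : ℝ≥0) : MapsTo (translate τ) (SInfty U) (SInfty U) := by
  rintro u ⟨f, hf, hlim⟩
  refine ⟨fun n r => f n (r + τ), fun n => (hf n).translate τ.2, fun t₀ ht₀ => ?_⟩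
  refine tendsto_of_tendsto_of_tendsto_of_le_of_le tendsto_const_nhds
    (hlim (t₀ + τ) (add_pos_of_pos_of_nonneg ht₀ τ.2)) (fun _ => zero_le) fun n => ?_
  simp only [eLpNorm_exponent_top]
  refine essSup_le_of_ae_le _ ((ae_restrict_iff' measurableSet_Icc).2 ?_)
  have h1 : ∀ᵐ r, r ∈ Icc (0 : ℝ) (t₀ + τ) → ‖f n r - u r‖ₑ
      ≤ eLpNormEssSup (fun r => f n r - u r) (volume.restrict (Icc 0 (t₀ + τ))) :=
    (ae_restrict_iff' measurableSet_Icc).1 (ae_le_eLpNormEssSup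
      (f := fun r => f n r - u r) (μ := volume.restrict (Icc 0 (t₀ + τ))))
  have h2 := (measurePreserving_add_right volume (τ : ℝ)).quasiMeasurePreserving.ae h1
  filter_upwards [h2, ae_translate_eq τ u] with r hr hr' hm
  rw [hr' hm.1]
  exact hr ⟨add_nonneg hm.1 τ.2, add_le_add_left hm.2 _⟩

end Inputs

/-! ### Comparison functions of exponential type -/

theorem isClassKL_mul_exp {κ : ℝ} (hκ : 0 < κ) :
    IsClassKL fun r t => r * Real.toNNReal (Real.exp (-κ * t)) := by
  have hpos : ∀ t : ℝ≥0, 0 < Real.toNNReal (Real.exp (-κ * t)) := fun t =>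
    Real.toNNReal_pos.2 (Real.exp_pos _)
  have hc : Continuous fun t : ℝ≥0 => Real.toNNReal (Real.exp (-κ * t)) :=
    continuous_real_toNNReal.comp (by fun_prop)
  refine ⟨continuous_fst.mul (hc.comp continuous_snd), fun t => ⟨continuous_id.mul continuous_const,
    fun a b hab => mul_lt_mul_of_pos_right hab (hpos t), zero_mul _⟩, fun r hr =>
    ⟨continuous_const.mul hc, fun a b hab => mul_lt_mul_of_pos_left ?_ hr, ?_⟩⟩
  · refine (Real.toNNReal_lt_toNNReal_iff (Real.exp_pos _)).2 (Real.exp_lt_exp.2 ?_)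
    have : (a : ℝ) < b := hab
    nlinarith
  · have h1 : Tendsto (fun t : ℝ≥0 => Real.exp (-κ * t)) atTop (𝓝 0) := by
      refine Real.tendsto_exp_atBot.comp ?_
      exact (NNReal.tendsto_coe_atTop.2 tendsto_id).const_mul_atTop_of_neg (by linarith)
    have h2 := (tendsto_real_toNNReal h1).const_mul r
    simpa using h2

theorem isClassK_const_mul {a : ℝ≥0} (ha : 0 < a) : IsClassK fun r => a * r :=
  ⟨continuous_const.mul continuous_id, fun _ _ h => mul_lt_mul_of_pos_left h ha, mul_zero _⟩

/-! ### Solution families -/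

section SolutionFamily

variable {X : Type*} [NormedAddCommGroup X] {g : X → X} {f : ℝ → X}

/-- Solutions obeying a bound `‖x t‖ ≤ ‖x₀‖ + c` depend continuously on the initial value `x₀`. -/
theorem continuous_of_isMildOn [NormedSpace ℝ X] {T : ℝ → X →L[ℝ] X} {s b c : ℝ} {x : X → ℝ → X}
    (hT : IsC0Semigroup T) (hb : ∀ t : ℝ, 0 ≤ t → ‖T t‖ ≤ 1)
    (hg : ∀ B : Set X, Bornology.IsBounded B → ∃ K : ℝ≥0, LipschitzOnWith K g B)
    (hf : ∀ t, s ≤ t → IntervalIntegrable f volume s t) (hsb : s ≤ b)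
    (hx : ∀ x₀, IsMildOn T g f s x₀ (Icc s b) (x x₀))
    (hxc : ∀ x₀, ∀ t ∈ Icc s b, ‖x x₀ t‖ ≤ ‖x₀‖ + c) :
    Continuous fun x₀ => x x₀ b := by
  refine continuous_iff_continuousAt.2 fun x₀ => ?_
  obtain ⟨K, hK⟩ := hg (Metric.closedBall 0 (‖x₀‖ + 1 + c)) Metric.isBounded_closedBall
  have hmem : ∀ y ∈ Metric.ball x₀ 1, ∀ t ∈ Icc s b,
      x y t ∈ Metric.closedBall 0 (‖x₀‖ + 1 + c) := fun y hy t ht => by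
    have h1 : ‖y‖ ≤ ‖x₀‖ + 1 := by
      have h2 := norm_sub_norm_le y x₀
      rw [Metric.mem_ball, dist_eq_norm] at hy
      linarith
    rw [mem_closedBall_zero_iff]
    linarith [hxc y t ht]
  have hL : LipschitzOnWith (Real.toNNReal (Real.exp (K * (b - s)))) (fun y => x y b)
      (Metric.ball x₀ 1) := by
    refine LipschitzOnWith.of_dist_le_mul fun y hy z hz => ?_
    rw [Real.coe_toNNReal _ (Real.exp_pos _).le, dist_eq_norm, dist_eq_norm, mul_comm]
    exact (hx y).norm_sub_le hT hb (continuous_of_lipschitzOnWith_bounded hg) hf (hx z) hK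
      (hmem y hy) (hmem z hz) b ⟨hsb, le_rfl⟩
  exact hL.continuousOn.continuousAt (Metric.ball_mem_nhds x₀ one_pos)

/-- The a priori bound in the form of an input-to-state estimate. -/
theorem IsMildOn.norm_le [InnerProductSpace ℝ X] [CompleteSpace X] {T : ℝ → X →L[ℝ] X}
    {s b ω : ℝ} {xs : X} {x : ℝ → X} (hT : IsC0Semigroup T) (hω : 0 < ω)
    (hTω : ∀ t : ℝ, 0 ≤ t → ‖T t‖ ≤ Real.exp (-ω * t)) (hgc : Continuous g)
    {C ω' : ℝ} (hC : 0 ≤ C) (hω' : ω' < ω)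
    (hgC : ∀ x : X, inner ℝ x (g x) ≤ C + ω' * ‖x‖ ^ 2)
    (hf : ∀ t, s ≤ t → IntervalIntegrable f volume s t) {M : ℝ} (hM : 0 ≤ M)
    (hfM : ∀ᵐ r, s ≤ r → ‖f r‖ ≤ M) (hx : IsMildOn T g f s xs (Icc s b) x) :
    ∀ t ∈ Icc s b, ‖x t‖ ≤ ‖xs‖ * Real.exp (-((ω - ω') / 2) * (t - s))
      + Real.sqrt (2 * C / (ω - ω')) + M / (ω - ω') := by
  intro t ht
  have hδ : 0 < ω - ω' := sub_pos.2 hω'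
  have h1 := hx.sq_norm_le hT hω hTω hgc hC hω' hgC hf hfM t ht
  set δ := ω - ω'
  set a := ‖xs‖ * Real.exp (-(δ / 2) * (t - s)) with ha
  have ha0 : 0 ≤ a := by positivity
  have ha2 : a ^ 2 = ‖xs‖ ^ 2 * Real.exp (-δ * (t - s)) := by
    rw [ha, mul_pow, ← Real.exp_nat_mul]; congr 2; push_cast; ring
  have hs0 := Real.sqrt_nonneg (2 * C / δ)
  have hs2 : Real.sqrt (2 * C / δ) ^ 2 = 2 * C / δ := Real.sq_sqrt (by positivity)
  have hm0 : 0 ≤ M / δ := by positivity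
  have h2 : (2 * C + M ^ 2 / δ) / δ = 2 * C / δ + (M / δ) ^ 2 := by field_simp
  rw [h2, ← ha2, ← hs2] at h1
  refine abs_le_of_sq_le_sq' (h1.trans ?_) (by positivity) |>.2
  nlinarith [mul_nonneg ha0 hs0, mul_nonneg ha0 hm0, mul_nonneg hs0 hm0]

end SolutionFamily

end ISpSMild

/-! ### Well-posedness, global attractor and practical stability -/

open ISpSMild in
theorem mainTheorem4 {X U : Type*}
    [NormedAddCommGroup X] [InnerProductSpace ℝ X] [CompleteSpace X]
    [NormedAddCommGroup U] [InnerProductSpace ℝ U] [CompleteSpace U]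
    [TopologicalSpace.SeparableSpace U]
    (A : X →ₗ.[ℝ] X) (T : ℝ → X →L[ℝ] X) (g : X → X) (h : U →L[ℝ] X)
    (hA : ISpSMild.Generates A T) (hT : ISpSMild.IsCompactSemigroup T)
    (hg : ∀ B : Set X, Bornology.IsBounded B → ∃ K : ℝ≥0, LipschitzOnWith K g B)
    (ω C ω' : ℝ) (hω : 0 < ω) (hω' : ω' < ω)
    (hTω : ∀ t : ℝ, 0 ≤ t → ‖T t‖ ≤ Real.exp (-ω * t))
    (hgC : ∀ x : X, inner ℝ x (g x) ≤ C + ω' * ‖x‖ ^ 2) :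
    ∃ S : ISpSMild.SInfty U → ℝ → ℝ → X → X,
      -- the maximal mild solutions exist, are unique and global, and are given by `S`
      (∀ (u : ISpSMild.SInfty U) (s : ℝ) (xs : X), 0 ≤ s →
        ISpSMild.IsMaximalMildSolution T g h (u : ISpSMild.LInfty U) s xs ⊤
          (fun t => S u t s xs) ∧
        ∀ (τ : EReal) (x : ℝ → X),
          ISpSMild.IsMaximalMildSolution T g h (u : ISpSMild.LInfty U) s xs τ x →
            τ = ⊤ ∧ ∀ t : ℝ, s ≤ t → x t = S u t s xs) ∧
      ISpSMild.IsSemiprocessFamily (ISpSMild.SInfty U) ISpSMild.translate S ∧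
      ∃ Θ : Set X,
        ISpSMild.IsGlobalAttractor S {ISpSMild.zeroInput U} Θ ∧
        (∀ Θ' : Set X, ISpSMild.IsGlobalAttractor S {ISpSMild.zeroInput U} Θ' → Θ' = Θ) ∧
        ISpSMild.IsISpS S Θ := by
  have hT0 : IsC0Semigroup T := hA.isC0Semigroup
  have hb : ∀ t : ℝ, 0 ≤ t → ‖T t‖ ≤ 1 := fun t ht =>
    (hTω t ht).trans (Real.exp_le_one_iff.2 (by nlinarith))
  have hgc : Continuous g := continuous_of_lipschitzOnWith_bounded hg
  -- `C` and `ω'` may be assumed nonnegative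
  obtain ⟨C, hC0, ω', hω'0, hω', hgC⟩ : ∃ C₁ : ℝ, 0 ≤ C₁ ∧ ∃ ω₁ : ℝ, 0 ≤ ω₁ ∧ ω₁ < ω ∧
      ∀ x : X, inner ℝ x (g x) ≤ C₁ + ω₁ * ‖x‖ ^ 2 :=
    ⟨|C|, abs_nonneg C, max ω' 0, le_max_right _ _, max_lt hω' hω, fun x =>
      (hgC x).trans (add_le_add (le_abs_self C)
        (mul_le_mul_of_nonneg_right (le_max_left _ _) (by positivity)))⟩
  have hδ : 0 < ω - ω' := sub_pos.2 hω'
  set κ := (ω - ω') / 2 with hκ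
  have hκ0 : 0 < κ := half_pos hδ
  have hf : ∀ (u : LInfty U) (s : ℝ), 0 ≤ s →
      ∀ t, s ≤ t → IntervalIntegrable (fun r => h (u r)) volume s t := fun u s hs t hst =>
    ⟨h.integrable_comp (intervalIntegrable_LInfty u hs hst).1,
      h.integrable_comp (intervalIntegrable_LInfty u hs hst).2⟩
  have hfM : ∀ (u : LInfty U) (s : ℝ), 0 ≤ s → ∀ᵐ r, s ≤ r → ‖h (u r)‖ ≤ ‖h‖ * ‖u‖ := by
    intro u s hs
    filter_upwards [ae_norm_le_norm_LInfty u] with r hr hsr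
    exact (h.le_opNorm _).trans (by gcongr; exact hr (hs.trans hsr))
  have hex : ∀ (u : SInfty U) (s : ℝ) (xs : X), ∃ x : ℝ → X, 0 ≤ s →
      IsMildOn T g (fun r => h ((u : LInfty U) r)) s xs (Ici s) x := by
    intro u s xs
    by_cases hs : 0 ≤ s
    · obtain ⟨x, hx⟩ := exists_isMildOn hT0 hω hTω hg hC0 hω'0 hω' hgC (hf u s hs)
        (by positivity) (hfM u s hs) xs
      exact ⟨x, fun _ => hx⟩
    · exact ⟨0, fun h => absurd h hs⟩
  choose sol hsol using hex
  have huniq : ∀ (u : SInfty U) (s : ℝ) (xs : X) (x : ℝ → X), 0 ≤ s →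
      IsMildOn T g (fun r => h ((u : LInfty U) r)) s xs (Ici s) x →
      ∀ t, s ≤ t → x t = sol u s xs t := fun u s xs x hs hx t ht =>
    (hx.mono (Icc_subset_Ici_self : Icc s t ⊆ Ici s)).unique hT0 hb hg (hf u s hs)
      ((hsol u s xs hs).mono Icc_subset_Ici_self) (right_mem_Icc.2 ht)
  have hsemi : IsSemiprocessFamily (SInfty U) translate (fun u t s xs => sol u s xs t) := by
    refine ⟨mapsTo_translate_SInfty, fun u s x hs => (hsol u s x hs).initial hT0 self_mem_Ici,
      fun u r s t x hr hrs hst => ?_, fun u s t τ x hs hst => ?_⟩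
    · exact (huniq u s _ _ (hr.trans hrs)
        ((hsol u r x hr).restart hT0 hb hgc (hf u r hr) hrs) t hst).symm
    · refine huniq ⟨translate τ u, _⟩ s x (fun t => sol u (s + τ) x (t + τ)) hs
        ((hsol u (s + τ) x (add_nonneg hs τ.2)).shift ?_) t hst
      filter_upwards [ae_translate_eq τ (u : LInfty U)] with r hr hsr
      rw [hr (hs.trans hsr)]
  have hest : ∀ (u : SInfty U) (x₀ : X) (t : ℝ), 0 ≤ t → ‖sol u 0 x₀ t‖
      ≤ ‖x₀‖ * Real.exp (-κ * t) + Real.sqrt (2 * C / (ω - ω'))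
        + ‖h‖ * ‖(u : LInfty U)‖ / (ω - ω') := fun u x₀ t ht => by
    have := ((hsol u 0 x₀ le_rfl).mono (Icc_subset_Ici_self : Icc 0 t ⊆ Ici 0)).norm_le hT0 hω hTω
      hgc hC0 hω' hgC (hf u 0 le_rfl) (by positivity) (hfM u 0 le_rfl) t (right_mem_Icc.2 ht)
    rwa [sub_zero] at this
  set ρ := Real.sqrt (2 * C / (ω - ω')) with hρ
  have hρ0 : 0 ≤ ρ := Real.sqrt_nonneg _
  have hest0 : ∀ (x₀ : X) (t : ℝ), 0 ≤ t → ‖sol (zeroInput U) 0 x₀ t‖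
      ≤ ‖x₀‖ * Real.exp (-κ * t) + ρ := fun x₀ t ht => by
    have := hest (zeroInput U) x₀ t ht
    have h0 : ‖((zeroInput U : SInfty U) : LInfty U)‖ = 0 := norm_zero
    rwa [h0, mul_zero, zero_div, add_zero] at this
  have hest1 : ∀ (x₀ : X) (t : ℝ), 0 ≤ t → ‖sol (zeroInput U) 0 x₀ t‖ ≤ ‖x₀‖ + ρ := by
    intro x₀ t ht
    have h1 : Real.exp (-κ * t) ≤ 1 := Real.exp_le_one_iff.2 (by nlinarith)
    have h2 : ‖x₀‖ * Real.exp (-κ * t) ≤ ‖x₀‖ := mul_le_of_le_one_right (norm_nonneg _) h1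
    linarith [hest0 x₀ t ht]
  have hadd : ∀ (s t : ℝ) (x : X), 0 ≤ s → 0 ≤ t → sol (zeroInput U) 0 x (s + t)
      = sol (zeroInput U) 0 (sol (zeroInput U) 0 x s) t := by
    intro s t x hs ht
    lift s to ℝ≥0 using hs
    have h1 := hsemi.trans (zeroInput U) 0 s (s + t) x le_rfl s.2 (by linarith)
    have h2 := hsemi.translation (zeroInput U) 0 t s (sol (zeroInput U) 0 x s) le_rfl ht
    have h3 : (⟨translate s (zeroInput U : SInfty U), hsemi.invariant s (zeroInput U).2⟩ :
        SInfty U) = zeroInput U := Subtype.ext (translate_zero _)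
    rw [h3, zero_add, add_comm t] at h2
    exact h1.symm.trans h2
  have habs : ∀ B : Set X, Bornology.IsBounded B → ∃ t₀, 0 ≤ t₀ ∧ ∀ t, t₀ ≤ t →
      MapsTo (fun x => sol (zeroInput U) 0 x t) B (Metric.closedBall 0 (ρ + 1)) := by
    intro B hB
    obtain ⟨b, hb⟩ := hB.exists_norm_le
    have h1 : Tendsto (fun t => b * Real.exp (-κ * t)) atTop (𝓝 0) := by
      have h2 : Tendsto (fun t => Real.exp (-κ * t)) atTop (𝓝 0) :=
        Real.tendsto_exp_atBot.comp (tendsto_id.const_mul_atTop_of_neg (by linarith))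
      simpa using h2.const_mul b
    obtain ⟨t₁, ht₁⟩ := eventually_atTop.1 (h1.eventually_le_const one_pos)
    refine ⟨max t₁ 0, le_max_right _ _, fun t ht x hx => ?_⟩
    have h3 := hest0 x t ((le_max_right _ _).trans ht)
    have h4 := ht₁ t ((le_max_left _ _).trans ht)
    have h5 : ‖x‖ * Real.exp (-κ * t) ≤ b * Real.exp (-κ * t) := by
      gcongr; exact hb x hx
    rw [mem_closedBall_zero_iff]
    linarith
  -- solutions from the absorbing ball of radius `ρ + 1` stay in the ball of radius `ρ + 1 + ρ`
  obtain ⟨Θ, hΘc, hΘa, hΘi⟩ := exists_compact_attracting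
    (ϕ := fun t x => sol (zeroInput U) 0 x t) (B := Metric.closedBall 0 (ρ + 1))
    (fun t ht => continuous_of_isMildOn hT0 hb hg (hf _ 0 le_rfl) ht
      (fun x₀ => (hsol (zeroInput U) 0 x₀ le_rfl).mono Icc_subset_Ici_self)
      (fun x₀ r hr => hest1 x₀ r hr.1))
    hadd Metric.isBounded_closedBall habs
    (TotallyBounded.isCompact_of_isClosed (totallyBounded_image_of_isMildOn (R := ρ + 1 + ρ)
      hT0 hT hb hg (hf (zeroInput U : SInfty U) 0 le_rfl) (by positivity)
      (hfM (zeroInput U : SInfty U) 0 le_rfl)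
      (fun x₀ _ => (hsol (zeroInput U) 0 x₀ le_rfl).mono Icc_subset_Ici_self)
      (fun x₀ hx₀ t ht => (hest1 x₀ t ht.1).trans
        (add_le_add_left (mem_closedBall_zero_iff.1 hx₀) _))).closure isClosed_closure)
  have hset : ∀ (t : ℝ) (B : Set X), setSemiprocess (fun u t s xs => sol u s xs t)
      {zeroInput U} t 0 B = (fun x => sol (zeroInput U) 0 x t) '' B := by
    intro t B
    ext y
    simp only [setSemiprocess, mem_singleton_iff, exists_eq_left, mem_ofPred_eq, mem_image, eq_comm]
  have hattr : IsGlobalAttractor (fun u t s xs => sol u s xs t) {zeroInput U} Θ := by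
    refine ⟨hΘc, fun B hB => ?_, fun t ht => by rw [hset]; exact hΘi t ht⟩
    rw [ENNReal.tendsto_nhds_zero]
    intro ε hε
    obtain ⟨ε', hε'0, hε'⟩ : ∃ ε' : ℝ, 0 < ε' ∧ ENNReal.ofReal ε' ≤ ε := by
      rcases eq_or_ne ε ∞ with rfl | hne
      · exact ⟨1, one_pos, le_top⟩
      · exact ⟨ε.toReal, ENNReal.toReal_pos hε.ne' hne, ENNReal.ofReal_toReal_le⟩
    filter_upwards [hΘa B hB ε' hε'0] with t ht
    rw [hset]
    refine iSup₂_le fun y hy => ?_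
    obtain ⟨x, hx, rfl⟩ := hy
    exact (Metric.mem_thickening_iff_infEDist_lt.1 (ht hx)).le.trans hε'
  -- an empty set has empty thickenings and attracts no point
  obtain ⟨θ₀, hθ₀⟩ : Θ.Nonempty := by
    obtain ⟨t, ht⟩ := (hΘa {0} Bornology.isBounded_singleton 1 one_pos).exists
    obtain ⟨θ, hθ, -⟩ := Metric.mem_thickening_iff.1 (ht (mem_singleton 0))
    exact ⟨θ, hθ⟩
  refine ⟨fun u t s xs => sol u s xs t, fun u s xs hs => ?_, hsemi, Θ, hattr,
    fun Θ' hΘ' => (hattr.subset hΘ').antisymm (hΘ'.subset hattr), ?_⟩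
  · have hm := (hsol u s xs hs).isMildSolution hT0 hb hgc (hf u s hs)
    refine ⟨⟨hm, fun τ' x' hτ' => absurd hτ' not_top_lt⟩, fun τ x hx => ?_⟩
    have heq : EqOn (sol u s xs) x (timeInterval s τ) := fun t ht =>
      (((hsol u s xs hs).mono Icc_subset_Ici_self).unique hT0 hb hg (hf u s hs)
        (hx.isMildSolution.isMildOn hT0 hb hgc (hf u s hs) ht) (right_mem_Icc.2 ht.1))
    have hτ : τ = ⊤ := by
      by_contra hne
      exact hx.maximal ⊤ _ (lt_top_iff_ne_top.2 hne) hm heq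
    subst hτ
    exact ⟨rfl, fun t ht => (heq ⟨ht, EReal.coe_lt_top t⟩).symm⟩
  · obtain ⟨r, hr⟩ := hΘc.isBounded.exists_norm_le
    have hr0 : 0 ≤ r := (norm_nonneg _).trans (hr θ₀ hθ₀)
    -- `r` bounds the norm on `Θ`; it enters once for `x₀` and once for the solution
    refine ⟨_, _, Real.toNNReal (2 * r + ρ), isClassKL_mul_exp hκ0,
      isClassK_const_mul (a := Real.toNNReal (‖h‖ / (ω - ω')) + 1) (by positivity),
      fun x₀ u t => ?_⟩
    rw [← NNReal.coe_le_coe]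
    push_cast
    rw [Real.coe_toNNReal _ (Real.exp_pos _).le, Real.coe_toNNReal _ (by positivity),
      Real.coe_toNNReal _ (by positivity)]
    simp only [Metric.coe_infNndist]
    obtain ⟨θ, hθ, hθd⟩ := hΘc.exists_infDist_eq_dist ⟨θ₀, hθ₀⟩ x₀
    have h1 : Metric.infDist (sol u 0 x₀ t) Θ ≤ ‖sol u 0 x₀ t‖ + r := by
      refine (Metric.infDist_le_dist_of_mem hθ₀).trans ?_
      rw [dist_eq_norm]
      exact (norm_sub_le _ _).trans (by gcongr; exact hr θ₀ hθ₀)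
    have h2 : ‖x₀‖ ≤ Metric.infDist x₀ Θ + r := by
      rw [hθd, dist_eq_norm]
      have := norm_sub_norm_le x₀ θ
      linarith [hr θ hθ]
    have h3 : Real.exp (-κ * t) ≤ 1 := Real.exp_le_one_iff.2 (by nlinarith [t.2])
    have h4 : ‖x₀‖ * Real.exp (-κ * t) ≤ Metric.infDist x₀ Θ * Real.exp (-κ * t) + r := by
      have h5 : ‖x₀‖ * Real.exp (-κ * t) ≤ (Metric.infDist x₀ Θ + r) * Real.exp (-κ * t) := by
        gcongr
      have h6 : r * Real.exp (-κ * t) ≤ r := mul_le_of_le_one_right hr0 h3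
      linarith
    have h7 := hest u x₀ t t.2
    have h8 : ‖h‖ * ‖(u : LInfty U)‖ / (ω - ω') = ‖h‖ / (ω - ω') * ‖(u : LInfty U)‖ := by ring
    have h9 := norm_nonneg (u : LInfty U)
    linarith
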